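/- **Setting.** Let $M$ be a smooth finite-dimensional manifold (Hausdorff, $\sigma$-compact, without boundary) and let $\tau : A \to M$ be a smooth affine bundle of finite rank modelled on the vector bundle $V(A)\to M$. Let $A^\dagger \to M$ be the vector bundle whose fibre at $p$ is the space of affine functions $A_p \to \mathbb{R}$, let $\varphi = 1_A \in \mathrm{Sec}(A^\dagger)$ be the section which on every fibre is the constant function $1$, and let $\widehat A = (A^\dagger)^*$ be the vector hull of $A$. We view $A \subset \widehat A$ through $a \mapsto (f \mapsto f(a))$, whose image is the set $\{\iota_\varphi = 1\}$, and $V(A) \subset \widehat A$ through $v \mapsto (f \mapsto f_{\mathsf v}(v))$, where $f_{\mathsf v}$ is the linear part of $f$; the image of $V(A)$ is $\{\iota_\varphi = 0\}$. Here, for a section $\mu$ of a vector bundle, $\iota_\mu$ denotes the corresponding fibrewise linear function on the dual bundle. $\mathrm{Sec}$ denotes smooth sections. A *Lie algebroid* structure on a vector bundle $E\to M$ is a Lie bracket $[\cdot,\cdot]$ on $\mathrm{Sec}(E)$ together with a vector bundle morphism $\rho : E \to TM$ over $\mathrm{id}_M$ such that $[X, fY] = f[X,Y] + \rho(X)(f)\,Y$.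 A *Lie affgebroid* structure on $A$ is a skew-symmetric bi-affine bracket $[\cdot,\cdot] : \mathrm{Sec}(A)\times \mathrm{Sec}(A) \to \mathrm{Sec}(V(A))$ together with a morphism of affine bundles $\gamma : A \to TM$ over $\mathrm{id}_M$ such that, writing $[\alpha,\cdot]^{\mathsf v} : \mathrm{Sec}(V(A)) \to \mathrm{Sec}(V(A))$ for the linear part of $[\alpha, \cdot]$, $$[\alpha_1,[\alpha_2,\alpha_3]]^{\mathsf v} + [\alpha_2,[\alpha_3,\alpha_1]]^{\mathsf v} + [\alpha_3,[\alpha_1,\alpha_2]]^{\mathsf v} = 0, \qquad [\alpha, fX]^{\mathsf v} = f[\alpha,X]^{\mathsf v} + \gamma(\alpha)(f)\,X$$ for all $\alpha,\alpha_i \in \mathrm{Sec}(A)$, $X \in \mathrm{Sec}(V(A))$, $f \in C^\infty(M)$. Let a Lie algebroid structure $([\cdot,\cdot],\rho)$ be given on $\widehat A$. For $\mu \in \mathrm{Sec}(A^\dagger)$ and $X,Y\in \mathrm{Sec}(\widehat A)$ put $$d\mu(X,Y) = \rho(X)\langle \mu, Y\rangle - \rho(Y)\langle \mu, X\rangle -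 \langle \mu, [X,Y]\rangle, \qquad \langle\mathcal L_X\mu, Y\rangle = \rho(X)\langle\mu,Y\rangle - \langle\mu,[X,Y]\rangle .$$ Let $\Lambda$ be the corresponding linear Poisson tensor on the manifold $A^\dagger$ (with projection $\pi$ to $M$), that is, the unique bivector field with $\Lambda(d\iota_X, d\iota_Y) = \iota_{[X,Y]}$, $\Lambda(d\iota_X, d(f\circ\pi)) = \rho(X)(f)\circ\pi$ and $\Lambda(d(f\circ\pi),d(g\circ\pi)) = 0$ for all $X, Y \in \mathrm{Sec}(\widehat A)$ and $f,g\in C^\infty(M)$. The vertical lift $\mathcal V(\varphi)$ is the vector field on $A^\dagger$ whose value at $w$ is the velocity at $t=0$ of $t\mapsto w + t\,\varphi(\pi(w))$. For $X \in \mathrm{Sec}(\widehat A)$ the complete lift $X^c$ is the unique vector field on the manifold $\widehat A$ (with projection $\widehat\pi$ to $M$) such that $X^c(f\circ\widehat\pi) = \rho(X)(f)\circ\widehat\pi$ and $X^c(\iota_\mu) = \iota_{\mathcal L_X\mu}$ for all $f \in C^\infty(M)$ and $\mu\in\mathrm{Sec}(A^\dagger)$. **Theorem.** The following are equivalent: 1.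 the restriction of the bracket of $\widehat A$ to sections of $A$ is a Lie affgebroid bracket on $A$; 2. $[X,Y] \in \mathrm{Sec}(V(A))$ for all $X, Y \in \mathrm{Sec}(A)$; 3. $d\varphi = 0$; 4. the Lie derivative $\mathcal L_{\mathcal V(\varphi)}\Lambda$ of $\Lambda$ along $\mathcal V(\varphi)$ vanishes; 5. for every $X \in \mathrm{Sec}(A)$ the complete lift $X^c$ is tangent to the submanifold $A \subset \widehat A$. -/

import Mathlib

open Bundle Set
open scoped Manifold ContDiff Bundle Topology

noncomputable section

section AffineBundle

variable (E : Type*) [NormedAddCommGroup E] [NormedSpace ℝ E]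
  {M : Type*} [TopologicalSpace M] [ChartedSpace E M]
  (F : Type*) [NormedAddCommGroup F] [NormedSpace ℝ F]
  (V : M → Type*) [∀ p, AddCommGroup (V p)] [∀ p, Module ℝ (V p)]
  [∀ p, TopologicalSpace (V p)] [TopologicalSpace (TotalSpace F V)]
  [FiberBundle F V] [VectorBundle ℝ F V]
  (A : M → Type*) [∀ p, AddTorsor (V p) (A p)]
  [∀ p, TopologicalSpace (A p)] [TopologicalSpace (TotalSpace F A)] [FiberBundle F A]

/-- A fibre bundle `A → M` whose fibre `A p` is an affine space modelled on the fibre `V p` of a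
vector bundle is a *smooth affine bundle modelled on `V`* if its local trivializations are affine
on fibres, with linear part a smooth change of trivialization of `V`, and its transition maps
`x ↦ T p x + c p` depend smoothly on `p`. -/
class SmoothAffineBundle : Prop where
  exists_coordChange : ∀ (e e' : Trivialization F (π F A))
    [MemTrivializationAtlas e] [MemTrivializationAtlas e'],
    ∃ (T : M → F →L[ℝ] F) (c : M → F),
      ContMDiffOn 𝓘(ℝ, E) 𝓘(ℝ, F →L[ℝ] F) ∞ T (e.baseSet ∩ e'.baseSet) ∧
      ContMDiffOn 𝓘(ℝ, E) 𝓘(ℝ, F) ∞ c (e.baseSet ∩ e'.baseSet) ∧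
      ∀ p ∈ e.baseSet ∩ e'.baseSet, ∀ a : A p, (e' ⟨p, a⟩).2 = T p (e ⟨p, a⟩).2 + c p
  exists_linearPart : ∀ (e : Trivialization F (π F A)) (e' : Trivialization F (π F V))
    [MemTrivializationAtlas e] [MemTrivializationAtlas e'],
    ∃ T : M → F →L[ℝ] F,
      ContMDiffOn 𝓘(ℝ, E) 𝓘(ℝ, F →L[ℝ] F) ∞ T (e.baseSet ∩ e'.baseSet) ∧
      ∀ p ∈ e.baseSet ∩ e'.baseSet, ∀ (v : V p) (a : A p),
        (e ⟨p, v +ᵥ a⟩).2 = T p (e' ⟨p, v⟩).2 + (e ⟨p, a⟩).2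

/-- The fibre at `p` of `A†`: the real affine functions on `A p`. -/
def AffineDual (_E : Type*) {M : Type*} (_F : Type*) (V : M → Type*) [∀ p, AddCommGroup (V p)]
    [∀ p, Module ℝ (V p)] (A : M → Type*) [∀ p, AddTorsor (V p) (A p)] (p : M) : Type _ :=
  A p →ᵃ[ℝ] ℝ

/-- The model fibre of `A†`: the pair `(ℓ, b)` stands for the affine function `x ↦ ℓ x + b`. -/
abbrev AffineDualModel : Type _ := (F →L[ℝ] ℝ) × ℝ

namespace AffineDual

instance (p : M) : AddCommGroup (AffineDual E F V A p) :=
  inferInstanceAs (AddCommGroup (A p →ᵃ[ℝ] ℝ))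

instance (p : M) : Module ℝ (AffineDual E F V A p) :=
  inferInstanceAs (Module ℝ (A p →ᵃ[ℝ] ℝ))

instance (p : M) : FunLike (AffineDual E F V A p) (A p) ℝ :=
  inferInstanceAs (FunLike (A p →ᵃ[ℝ] ℝ) (A p) ℝ)

variable {E F V A}

@[ext] lemma ext {p : M} {f g : AffineDual E F V A p} (h : ∀ a, f a = g a) : f = g :=
  AffineMap.ext h

@[simp] lemma add_apply {p : M} (f g : AffineDual E F V A p) (a : A p) : (f + g) a = f a + g a :=
  rfl

@[simp] lemma smul_apply {p : M} (c : ℝ) (f : AffineDual E F V A p) (a : A p) :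
    (c • f) a = c * f a :=
  rfl

lemma map_vadd {p : M} (f : AffineDual E F V A p) (v : V p) (a : A p) :
    f (v +ᵥ a) = AffineMap.linear (k := ℝ) (V1 := V p) (V2 := ℝ) f v + f a :=
  AffineMap.map_vadd (k := ℝ) (V1 := V p) (V2 := ℝ) f a v

end AffineDual

/-- Affine functions on an affine space `P ≃ F`, `F` a finite-dimensional vector space, as pairs
`(ℓ, b)` with `f a = ℓ (g a) + b`. -/
def affineFunctionCoord {F W P : Type*} [NormedAddCommGroup F] [NormedSpace ℝ F]
    [FiniteDimensional ℝ F] [AddCommGroup W] [Module ℝ W] [AddTorsor W P] (g : P ≃ᵃ[ℝ] F) :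
    (P →ᵃ[ℝ] ℝ) ≃ₗ[ℝ] AffineDualModel F where
  toFun f := (LinearMap.toContinuousLinearMap (f.linear ∘ₗ g.symm.linear.toLinearMap),
    f (g.symm 0))
  map_add' f h := by
    ext x <;> simp
  map_smul' c f := by
    ext x <;> simp
  invFun m := ((m.1 : F →ₗ[ℝ] ℝ).toAffineMap + AffineMap.const ℝ F m.2).comp g.toAffineMap
  left_inv f := by
    ext a
    have h := AffineMap.map_vadd (f.comp g.symm.toAffineMap) 0 (g a)
    simp only [vadd_eq_add, add_zero, AffineMap.comp_apply, AffineEquiv.coe_toAffineMap,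
      AffineEquiv.symm_apply_apply] at h
    exact h.symm
  right_inv m := by
    ext x
    · simp
    · simp

variable [SmoothAffineBundle E F V A]

variable {F A} in
/-- A local trivialization of `A`, restricted to the fibre at `p`, is a bijection onto `F`. -/
def fiberEquiv (e : Trivialization F (π F A)) (p : M) (hp : p ∈ e.baseSet) : A p ≃ F :=
  Equiv.ofBijective (fun a => (e ⟨p, a⟩).2) <| by
    constructor
    · intro a b h
      have h1 : e ⟨p, a⟩ = e ⟨p, b⟩ :=
        Prod.ext (((e.coe_fst' (x := ⟨p, a⟩) hp)).trans (e.coe_fst' (x := ⟨p, b⟩) hp).symm) h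
      have := e.injOn (e.mem_source.2 hp) (e.mem_source.2 hp) h1
      simpa using this
    · intro x
      have h2 : (e.toOpenPartialHomeomorph.symm (p, x)).proj = p := e.proj_symm_apply' hp
      have h3 : e (e.toOpenPartialHomeomorph.symm (p, x)) = (p, x) := e.apply_symm_apply' hp
      generalize e.toOpenPartialHomeomorph.symm (p, x) = z at h2 h3
      obtain ⟨q, a⟩ := z
      obtain rfl : q = p := h2
      exact ⟨a, by simp only [h3]⟩

variable {F A} in
@[simp] lemma fiberEquiv_apply (e : Trivialization F (π F A)) (p : M) (hp : p ∈ e.baseSet)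
    (a : A p) : fiberEquiv e p hp a = (e ⟨p, a⟩).2 := rfl

variable {F A} in
/-- A local trivialization of the affine bundle `A`, restricted to the fibre at `p`, is an affine
isomorphism onto `F`. -/
def fiberAffineEquiv (e : Trivialization F (π F A)) [MemTrivializationAtlas e] (p : M)
    (hp : p ∈ e.baseSet) : A p ≃ᵃ[ℝ] F :=
  AffineEquiv.ofBijective (φ := AffineMap.mk (fun a => (e ⟨p, a⟩).2)
    ((((SmoothAffineBundle.exists_linearPart (E := E) (V := V) e
        (trivializationAt F V p)).choose p : F →L[ℝ] F) : F →ₗ[ℝ] F) ∘ₗ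
      ((trivializationAt F V p).continuousLinearEquivAt ℝ p
        (mem_baseSet_trivializationAt F V p)).toLinearEquiv.toLinearMap)
    (fun a v => by
      have h := (SmoothAffineBundle.exists_linearPart (E := E) (V := V) e
        (trivializationAt F V p)).choose_spec.2 p ⟨hp, mem_baseSet_trivializationAt F V p⟩ v a
      simpa using h)) (fiberEquiv e p hp).bijective

@[simp] lemma fiberAffineEquiv_apply (e : Trivialization F (π F A)) [MemTrivializationAtlas e]
    (p : M) (hp : p ∈ e.baseSet) (a : A p) : fiberAffineEquiv E V e p hp a = (e ⟨p, a⟩).2 := rfl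

namespace AffineDual

variable [FiniteDimensional ℝ F]

variable {F A} in
/-- The coordinates `(ℓ, b)` of an affine function on `A p` in a local trivialization of `A`. -/
def coordEquiv (e : Trivialization F (π F A)) [MemTrivializationAtlas e] (p : M)
    (hp : p ∈ e.baseSet) : AffineDual E F V A p ≃ₗ[ℝ] AffineDualModel F :=
  affineFunctionCoord (fiberAffineEquiv E V e p hp)

lemma coordEquiv_symm_apply (e : Trivialization F (π F A)) [MemTrivializationAtlas e] (p : M)
    (hp : p ∈ e.baseSet) (m : AffineDualModel F) (a : A p) :
    (coordEquiv E V e p hp).symm m a = m.1 (e ⟨p, a⟩).2 + m.2 := rfl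

lemma coordEquiv_apply (e : Trivialization F (π F A)) [MemTrivializationAtlas e] (p : M)
    (hp : p ∈ e.baseSet) (f : AffineDual E F V A p) (a : A p) :
    f a = (coordEquiv E V e p hp f).1 (e ⟨p, a⟩).2 + (coordEquiv E V e p hp f).2 := by
  rw [← coordEquiv_symm_apply E F V A e p hp, LinearEquiv.symm_apply_apply]

lemma coordEquiv_eq_iff (e : Trivialization F (π F A)) [MemTrivializationAtlas e] (p : M)
    (hp : p ∈ e.baseSet) (f : AffineDual E F V A p) (m : AffineDualModel F) :
    coordEquiv E V e p hp f = m ↔ ∀ a : A p, f a = m.1 (e ⟨p, a⟩).2 + m.2 := by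
  rw [← LinearEquiv.eq_symm_apply]
  exact ⟨fun h a => by rw [h, coordEquiv_symm_apply], fun h => AffineDual.ext h⟩

open Classical in
variable {F A} in
/-- The local trivialization of `A†` induced by a local trivialization of `A`. -/
def pretrivialization (e : Trivialization F (π F A)) [MemTrivializationAtlas e] :
    Pretrivialization (AffineDualModel F) (π (AffineDualModel F) (AffineDual E F V A)) where
  toFun z := (z.1, if h : z.1 ∈ e.baseSet then coordEquiv E V e z.1 h z.2 else 0)
  invFun y := ⟨y.1, if h : y.1 ∈ e.baseSet then (coordEquiv E V e y.1 h).symm y.2 else 0⟩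
  source := π (AffineDualModel F) (AffineDual E F V A) ⁻¹' e.baseSet
  target := e.baseSet ×ˢ univ
  map_source' _ h := ⟨h, mem_univ _⟩
  map_target' _ h := h.1
  left_inv' := by
    rintro ⟨p, f⟩ (h : p ∈ e.baseSet)
    simp [h]
  right_inv' := by
    rintro ⟨p, m⟩ ⟨h, -⟩
    replace h : p ∈ e.baseSet := h
    simp [h]
  open_target := e.open_baseSet.prod isOpen_univ
  baseSet := e.baseSet
  open_baseSet := e.open_baseSet
  source_eq := rfl
  target_eq := rfl
  proj_toFun _ _ := rfl

lemma pretrivialization_apply (e : Trivialization F (π F A)) [MemTrivializationAtlas e] {p : M}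
    (hp : p ∈ e.baseSet) (f : AffineDual E F V A p) :
    pretrivialization E V e ⟨p, f⟩ = (p, coordEquiv E V e p hp f) := by
  change (p, _) = _
  simp [hp]

lemma pretrivialization_symm (e : Trivialization F (π F A)) [MemTrivializationAtlas e] {p : M}
    (hp : p ∈ e.baseSet) (m : AffineDualModel F) :
    (pretrivialization E V e).symm p m = (coordEquiv E V e p hp).symm m := by
  have h := (pretrivialization E V e).mk_symm (b := p) hp m
  have h' : (pretrivialization E V e).toPartialEquiv.symm (p, m) =
      ⟨p, (coordEquiv E V e p hp).symm m⟩ := by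
    change TotalSpace.mk p _ = _
    simp [hp]
  exact TotalSpace.mk_inj.1 (h.trans h')

/-- The topology of the fibre of `A†` is that of the finite-dimensional space
`(F →L[ℝ] ℝ) × ℝ` of coordinates. -/
instance (p : M) : TopologicalSpace (AffineDual E F V A p) :=
  TopologicalSpace.induced
    (coordEquiv E V (trivializationAt F A p) p (mem_baseSet_trivializationAt F A p)) inferInstance

lemma isInducing_coordEquiv (p : M) : Topology.IsInducing
    (coordEquiv E V (trivializationAt F A p) p (mem_baseSet_trivializationAt F A p)) := ⟨rfl⟩

instance (p : M) : IsTopologicalAddGroup (AffineDual E F V A p) :=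
  topologicalAddGroup_induced
    (coordEquiv E V (trivializationAt F A p) p (mem_baseSet_trivializationAt F A p))

instance (p : M) : ContinuousSMul ℝ (AffineDual E F V A p) :=
  continuousSMul_induced
    (coordEquiv E V (trivializationAt F A p) p
      (mem_baseSet_trivializationAt F A p)).toLinearMap

instance (p : M) : T2Space (AffineDual E F V A p) :=
  (Topology.IsEmbedding.mk (isInducing_coordEquiv E F V A p)
    (LinearEquiv.injective _)).t2Space

instance (p : M) : FiniteDimensional ℝ (AffineDual E F V A p) :=
  LinearEquiv.finiteDimensional
    (coordEquiv E V (trivializationAt F A p) p (mem_baseSet_trivializationAt F A p)).symm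

lemma exists_contMDiffOn_coordChange (e e' : Trivialization F (π F A)) [MemTrivializationAtlas e]
    [MemTrivializationAtlas e'] :
    ∃ f : M → AffineDualModel F →L[ℝ] AffineDualModel F,
      ContMDiffOn 𝓘(ℝ, E) 𝓘(ℝ, AffineDualModel F →L[ℝ] AffineDualModel F) ∞ f
        (e.baseSet ∩ e'.baseSet) ∧
      ∀ p ∈ e.baseSet ∩ e'.baseSet, ∀ m : AffineDualModel F,
        f p m = (pretrivialization E V e' ⟨p, (pretrivialization E V e).symm p m⟩).2 := by
  obtain ⟨T, c, hT, hc, h⟩ :=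
    SmoothAffineBundle.exists_coordChange (E := E) (V := V) (A := A) e' e
  rw [inter_comm] at hT hc
  refine ⟨fun p => ContinuousLinearMap.inl ℝ (F →L[ℝ] ℝ) ℝ ∘L
      ((ContinuousLinearMap.compL ℝ F F ℝ).flip (T p) ∘L ContinuousLinearMap.fst ℝ _ _) +
      (ContinuousLinearMap.inr ℝ (F →L[ℝ] ℝ) ℝ ∘L
        (ContinuousLinearMap.apply ℝ ℝ (c p) ∘L ContinuousLinearMap.fst ℝ _ _) +
       ContinuousLinearMap.inr ℝ (F →L[ℝ] ℝ) ℝ ∘L ContinuousLinearMap.snd ℝ _ _), ?_, ?_⟩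
  · have h1 : ContMDiffOn 𝓘(ℝ, E) 𝓘(ℝ, (F →L[ℝ] ℝ) →L[ℝ] (F →L[ℝ] ℝ)) ∞
        (fun p => (ContinuousLinearMap.compL ℝ F F ℝ).flip (T p)) (e.baseSet ∩ e'.baseSet) :=
      (ContinuousLinearMap.contMDiff _).comp_contMDiffOn hT
    have h2 : ContMDiffOn 𝓘(ℝ, E) 𝓘(ℝ, (F →L[ℝ] ℝ) →L[ℝ] ℝ) ∞
        (fun p => ContinuousLinearMap.apply ℝ ℝ (c p)) (e.baseSet ∩ e'.baseSet) := by
      have hA : ContMDiff 𝓘(ℝ, F) 𝓘(ℝ, (F →L[ℝ] ℝ) →L[ℝ] ℝ) ∞ fun x : F =>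
          (ContinuousLinearMap.apply ℝ ℝ x : (F →L[ℝ] ℝ) →L[ℝ] ℝ) := by
        rw [contMDiff_iff_contDiff]
        exact ContinuousLinearMap.contDiff _
      exact hA.comp_contMDiffOn hc
    exact (contMDiffOn_const.clm_comp (h1.clm_comp contMDiffOn_const)).add
      ((contMDiffOn_const.clm_comp (h2.clm_comp contMDiffOn_const)).add contMDiffOn_const)
  · intro p hp m
    rw [pretrivialization_symm E F V A e hp.1, pretrivialization_apply E F V A e' hp.2]
    symm
    rw [coordEquiv_eq_iff]
    intro a
    rw [coordEquiv_symm_apply, h p hp.symm a]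
    simp [add_assoc]

/-- `A†` as a vector bundle. -/
def prebundle : VectorPrebundle ℝ (AffineDualModel F) (AffineDual E F V A) where
  pretrivializationAtlas := {t | ∃ (e : Trivialization F (π F A)) (_ : MemTrivializationAtlas e),
    t = pretrivialization E V e}
  pretrivialization_linear' := by
    rintro _ ⟨e, he, rfl⟩
    refine ⟨fun p hp => ?_⟩
    constructor
    · intro f g
      simp [pretrivialization_apply E F V A e hp]
    · intro r f
      simp [pretrivialization_apply E F V A e hp]
  pretrivializationAt p := pretrivialization E V (trivializationAt F A p)
  mem_base_pretrivializationAt p := mem_baseSet_trivializationAt F A p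
  pretrivialization_mem_atlas p := ⟨trivializationAt F A p, inferInstance, rfl⟩
  exists_coordChange := by
    rintro _ ⟨e, he, rfl⟩ _ ⟨e', he', rfl⟩
    obtain ⟨f, hf, h⟩ := exists_contMDiffOn_coordChange E F V A e e'
    exact ⟨f, hf.continuousOn, h⟩
  totalSpaceMk_isInducing p := by
    have h : (pretrivialization E V (trivializationAt F A p) ∘ TotalSpace.mk p) =
        (fun m => (p, m)) ∘
          coordEquiv E V (trivializationAt F A p) p (mem_baseSet_trivializationAt F A p) := by
      funext f
      exact pretrivialization_apply E F V A _ (mem_baseSet_trivializationAt F A p) f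
    rw [h]
    exact (isInducing_prodMkRight p).comp (isInducing_coordEquiv E F V A p)

instance : TopologicalSpace (TotalSpace (AffineDualModel F) (AffineDual E F V A)) :=
  (prebundle E F V A).totalSpaceTopology

instance : FiberBundle (AffineDualModel F) (AffineDual E F V A) :=
  (prebundle E F V A).toFiberBundle

instance : VectorBundle ℝ (AffineDualModel F) (AffineDual E F V A) :=
  (prebundle E F V A).toVectorBundle

instance : (prebundle E F V A).IsContMDiff 𝓘(ℝ, E) ∞ where
  exists_contMDiffCoordChange := by
    rintro _ ⟨e, he, rfl⟩ _ ⟨e', he', rfl⟩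
    obtain ⟨f, hf, h⟩ := exists_contMDiffOn_coordChange E F V A e e'
    exact ⟨f, hf, h⟩

instance : ContMDiffVectorBundle ∞ (AffineDualModel F) (AffineDual E F V A) 𝓘(ℝ, E) :=
  (prebundle E F V A).contMDiffVectorBundle 𝓘(ℝ, E)

lemma trivializationAt_apply {p q : M} (hq : q ∈ (trivializationAt F A p).baseSet)
    (f : AffineDual E F V A q) :
    trivializationAt (AffineDualModel F) (AffineDual E F V A) p ⟨q, f⟩ =
      (q, coordEquiv E V (trivializationAt F A p) q hq f) :=
  pretrivialization_apply E F V A _ hq f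

end AffineDual

end AffineBundle

section VectorBundle

variable (E : Type*) [NormedAddCommGroup E] [NormedSpace ℝ E]
  {M : Type*} [TopologicalSpace M] [ChartedSpace E M]
  (F : Type*) [NormedAddCommGroup F] [NormedSpace ℝ F]
  (V : M → Type*) [∀ p, TopologicalSpace (V p)] [TopologicalSpace (TotalSpace F V)]
  [FiberBundle F V]

/-- `Sec(V)`: the smooth sections of the bundle `V → M`. -/
abbrev Sec : Type _ := ContMDiffSection 𝓘(ℝ, E) F ∞ V

variable [∀ p, AddCommGroup (V p)] [∀ p, Module ℝ (V p)] [VectorBundle ℝ F V]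

variable {E F V} in
/-- The product of a smooth function and a smooth section. -/
def Sec.fsmul (f : C^∞⟮𝓘(ℝ, E), M; ℝ⟯) (X : Sec E F V) : Sec E F V :=
  ⟨fun p => f p • X p, f.contMDiff.smul_section X.contMDiff⟩

/-- The differential at `x` of a real function on a manifold, as a covector. -/
def differential {B H N : Type*} [NormedAddCommGroup B] [NormedSpace ℝ B] [TopologicalSpace H]
    (I : ModelWithCorners ℝ B H) [TopologicalSpace N] [ChartedSpace H N] (f : N → ℝ) (x : N) :
    TangentSpace I x →L[ℝ] ℝ :=
  mfderiv I 𝓘(ℝ, ℝ) f x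

/-- A Lie algebroid structure on the vector bundle `V → M`: a Lie bracket on `Sec(V)` and a
vector bundle morphism `anchor : V → TM` satisfying the Leibniz rule. -/
structure LieAlgebroid [IsManifold 𝓘(ℝ, E) 1 M] where
  bracket : Sec E F V →ₗ[ℝ] Sec E F V →ₗ[ℝ] Sec E F V
  bracket_skew : ∀ X Y, bracket X Y = -bracket Y X
  jacobi : ∀ X Y Z,
    bracket X (bracket Y Z) + bracket Y (bracket Z X) + bracket Z (bracket X Y) = 0
  anchor : ∀ p, V p →ₗ[ℝ] TangentSpace 𝓘(ℝ, E) p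
  contMDiff_anchor : ContMDiff (𝓘(ℝ, E).prod 𝓘(ℝ, F)) 𝓘(ℝ, E).tangent ∞
    (fun z : TotalSpace F V => (⟨z.1, anchor z.1 z.2⟩ : TangentBundle 𝓘(ℝ, E) M))
  leibniz : ∀ (X : Sec E F V) (f : C^∞⟮𝓘(ℝ, E), M; ℝ⟯) (Y : Sec E F V) (p : M),
    bracket X (Y.fsmul f) p =
      f p • bracket X Y p + differential 𝓘(ℝ, E) f p (anchor p (X p)) • Y p

/-- The dual vector bundle. -/
abbrev DualBundle : M → Type _ := fun p => V p →L[ℝ] Bundle.Trivial M ℝ p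

end VectorBundle

section Lifts

variable {E : Type*} [NormedAddCommGroup E] [NormedSpace ℝ E]
  {M : Type*} [TopologicalSpace M] [ChartedSpace E M] [IsManifold 𝓘(ℝ, E) 1 M]
  {F : Type*} [NormedAddCommGroup F] [NormedSpace ℝ F]
  {W : M → Type*} [∀ p, AddCommGroup (W p)] [∀ p, Module ℝ (W p)]
  [∀ p, TopologicalSpace (W p)] [TopologicalSpace (TotalSpace F W)]
  [FiberBundle F W] [VectorBundle ℝ F W]

/-- The linear function `ι_X` on `W` defined by a section `X` of `W*`. -/
def linearFun (X : Sec E (F →L[ℝ] ℝ) (DualBundle W)) (w : TotalSpace F W) : ℝ := X w.1 w.2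

/-- The linear function `ι_μ` on `W*` defined by a section `μ` of `W`. -/
def linearFunDual (μ : Sec E F W) (e : TotalSpace (F →L[ℝ] ℝ) (DualBundle W)) : ℝ := e.2 (μ e.1)

/-- The pairing `⟨μ, X⟩` of sections of `W` and `W*`. -/
def pairing (μ : Sec E F W) (X : Sec E (F →L[ℝ] ℝ) (DualBundle W)) (p : M) : ℝ := X p (μ p)

/-- The vertical lift of a section `μ` of `W`: the vector field on `W` whose value at `w` is the
velocity at `t = 0` of the curve `t ↦ w + t μ`. -/
def verticalLift (μ : Sec E F W) (w : TotalSpace F W) :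
    TangentSpace (𝓘(ℝ, E).prod 𝓘(ℝ, F)) w :=
  mfderiv 𝓘(ℝ, ℝ) (𝓘(ℝ, E).prod 𝓘(ℝ, F))
    (fun t : ℝ => (⟨w.1, w.2 + t • μ w.1⟩ : TotalSpace F W)) 0 (1 : ℝ)

variable (L : LieAlgebroid E (F →L[ℝ] ℝ) (DualBundle W))

/-- The Lie algebroid exterior derivative of the 1-form `μ`, a section of `W = (W*)*`. -/
def extDeriv₁ (μ : Sec E F W) (X Y : Sec E (F →L[ℝ] ℝ) (DualBundle W)) (p : M) : ℝ :=
  differential 𝓘(ℝ, E) (pairing μ Y) p (L.anchor p (X p)) -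
    differential 𝓘(ℝ, E) (pairing μ X) p (L.anchor p (Y p)) - pairing μ (L.bracket X Y) p

end Lifts

section AffineSections

variable {E : Type*} [NormedAddCommGroup E] [NormedSpace ℝ E]
  {M : Type*} [TopologicalSpace M] [ChartedSpace E M]
  {F : Type*} [NormedAddCommGroup F] [NormedSpace ℝ F]
  {V : M → Type*} [∀ p, AddCommGroup (V p)] [∀ p, Module ℝ (V p)]
  [∀ p, TopologicalSpace (V p)] [TopologicalSpace (TotalSpace F V)]
  [FiberBundle F V] [VectorBundle ℝ F V]
  {A : M → Type*} [∀ p, AddTorsor (V p) (A p)]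
  [∀ p, TopologicalSpace (A p)] [TopologicalSpace (TotalSpace F A)] [FiberBundle F A]
  [SmoothAffineBundle E F V A]

/-- Translation of a section of the affine bundle `A` by a section of its model bundle `V`. -/
instance : VAdd (Sec E F V) (Sec E F A) where
  vadd X α := ⟨fun p => X p +ᵥ α p, by
    intro p₀
    rw [contMDiffAt_section]
    obtain ⟨T, hT, h⟩ := SmoothAffineBundle.exists_linearPart (E := E)
      (trivializationAt F A p₀) (trivializationAt F V p₀)
    have hs : (trivializationAt F A p₀).baseSet ∩ (trivializationAt F V p₀).baseSet ∈ 𝓝 p₀ :=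
      Filter.inter_mem
        ((trivializationAt F A p₀).open_baseSet.mem_nhds (mem_baseSet_trivializationAt F A p₀))
        ((trivializationAt F V p₀).open_baseSet.mem_nhds (mem_baseSet_trivializationAt F V p₀))
    have hX := (contMDiffAt_section (n := ∞) p₀).1 (X.contMDiff p₀)
    have hα := (contMDiffAt_section (n := ∞) p₀).1 (α.contMDiff p₀)
    refine (((hT.contMDiffAt hs).clm_apply hX).add hα).congr_of_eventuallyEq ?_
    filter_upwards [hs] with p hp using h p hp (X p) (α p)⟩

@[simp] lemma Sec.vadd_apply (X : Sec E F V) (α : Sec E F A) (p : M) : (X +ᵥ α) p = X p +ᵥ α p :=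
  rfl

variable (E F V A) in
/-- A Lie affgebroid structure on the affine bundle `A` modelled on `V`. For `α ∈ Sec(A)`, the map
`bracket α` is affine with linear part `linPart α`, and `anchor` is a morphism of affine bundles
from `A` to `TM`. -/
structure LieAffgebroid [IsManifold 𝓘(ℝ, E) 1 M] where
  bracket : Sec E F A → Sec E F A → Sec E F V
  linPart : Sec E F A → Sec E F V →ₗ[ℝ] Sec E F V
  bracket_vadd : ∀ α X β, bracket α (X +ᵥ β) = linPart α X + bracket α β
  bracket_skew : ∀ α β, bracket α β = -bracket β α
  jacobi : ∀ α₁ α₂ α₃, linPart α₁ (bracket α₂ α₃) + linPart α₂ (bracket α₃ α₁) +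
    linPart α₃ (bracket α₁ α₂) = 0
  anchor : ∀ p, A p →ᵃ[ℝ] TangentSpace 𝓘(ℝ, E) p
  contMDiff_anchor : ContMDiff (𝓘(ℝ, E).prod 𝓘(ℝ, F)) 𝓘(ℝ, E).tangent ∞
    (fun z : TotalSpace F A => (⟨z.1, anchor z.1 z.2⟩ : TangentBundle 𝓘(ℝ, E) M))
  leibniz : ∀ (α : Sec E F A) (f : C^∞⟮𝓘(ℝ, E), M; ℝ⟯) (X : Sec E F V) (p : M),
    linPart α (X.fsmul f) p =
      f p • linPart α X p + differential 𝓘(ℝ, E) f p (anchor p (α p)) • X p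

variable [FiniteDimensional ℝ F]

variable (E F V A) in
/-- The vector hull `Â = (A†)*`. -/
abbrev VectorHull : M → Type _ := DualBundle (AffineDual E F V A)

variable (F) in
/-- The model fibre of `Â`. -/
abbrev VectorHullModel : Type _ := AffineDualModel F →L[ℝ] ℝ

variable (E F V A) in
/-- The constant affine function `1` on `A p`. -/
def AffineDual.one (p : M) : AffineDual E F V A p := AffineMap.const ℝ (A p) (1 : ℝ)

variable (E F V A) in
/-- The section `1_A` of `A†`: the constant function `1` on every fibre. -/
def oneSection : Sec E (AffineDualModel F) (AffineDual E F V A) :=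
  ⟨fun p => AffineDual.one E F V A p, by
    intro p₀
    rw [contMDiffAt_section]
    refine (contMDiffAt_const (c := ((0, 1) : AffineDualModel F))).congr_of_eventuallyEq ?_
    filter_upwards [(trivializationAt F A p₀).open_baseSet.mem_nhds
      (mem_baseSet_trivializationAt F A p₀)] with p hp
    rw [AffineDual.trivializationAt_apply E F V A hp]
    refine (AffineDual.coordEquiv_eq_iff E F V A _ p hp _ _).2 fun a => ?_
    simp only [_root_.zero_apply, zero_add]
    rfl⟩

variable (E F V) in
/-- The embedding `A ↪ Â` on fibres: a point is sent to the evaluation at it. -/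
def hullPoint {p : M} (a : A p) : VectorHull E F V A p :=
  LinearMap.toContinuousLinearMap
    { toFun := fun f : AffineDual E F V A p => f a
      map_add' := fun _ _ => rfl
      map_smul' := fun _ _ => rfl }

variable (E F A) in
/-- The embedding `V(A) ↪ Â` on fibres: a vector is sent to `f ↦ f_v(v)`, where `f_v` is the
linear part of the affine function `f`. -/
def hullVector {p : M} (v : V p) : VectorHull E F V A p :=
  LinearMap.toContinuousLinearMap
    { toFun := fun f : AffineDual E F V A p => AffineMap.linear (k := ℝ) (V1 := V p) (V2 := ℝ) f v
      map_add' := fun _ _ => rfl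
      map_smul' := fun _ _ => rfl }

variable (E F V A) in
/-- The embedding `A ↪ Â` as a map between the total spaces. -/
def hullMap (a : TotalSpace F A) : TotalSpace (VectorHullModel F) (VectorHull E F V A) :=
  ⟨a.1, hullPoint E F V a.2⟩

/-- A section of `A` as a section of `Â`. -/
def hullSection (α : Sec E F A) : Sec E (VectorHullModel F) (VectorHull E F V A) :=
  ⟨fun p => hullPoint E F V (α p), by
    intro p₀
    rw [contMDiffAt_section]
    have hα := (contMDiffAt_section (n := ∞) p₀).1 (α.contMDiff p₀)
    have hA : ContMDiff 𝓘(ℝ, F) 𝓘(ℝ, (F →L[ℝ] ℝ) →L[ℝ] ℝ) ∞ fun x : F =>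
        (ContinuousLinearMap.apply ℝ ℝ x : (F →L[ℝ] ℝ) →L[ℝ] ℝ) := by
      rw [contMDiff_iff_contDiff]
      exact ContinuousLinearMap.contDiff _
    have h : ContMDiffAt 𝓘(ℝ, E) 𝓘(ℝ, VectorHullModel F) ∞
        (fun p => (ContinuousLinearMap.apply ℝ ℝ (trivializationAt F A p₀ ⟨p, α p⟩).2 :
            (F →L[ℝ] ℝ) →L[ℝ] ℝ) ∘L ContinuousLinearMap.fst ℝ _ _ +
          ContinuousLinearMap.snd ℝ (F →L[ℝ] ℝ) ℝ) p₀ :=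
      ((hA.contMDiffAt.comp p₀ hα).clm_comp contMDiffAt_const).add contMDiffAt_const
    refine h.congr_of_eventuallyEq ?_
    filter_upwards [(trivializationAt F A p₀).open_baseSet.mem_nhds
      (mem_baseSet_trivializationAt F A p₀)] with p hp
    refine ContinuousLinearMap.ext fun m => ?_
    have hp' : p ∈ (trivializationAt (AffineDualModel F) (AffineDual E F V A) p₀).baseSet := hp
    rw [hom_trivializationAt_apply]
    have h1 : (trivializationAt (AffineDualModel F) (AffineDual E F V A) p₀).symm p m =
        (AffineDual.coordEquiv E V (trivializationAt F A p₀) p hp).symm m :=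
      AffineDual.pretrivialization_symm E F V A (trivializationAt F A p₀) hp m
    have h2 := AffineDual.coordEquiv_symm_apply E F V A (trivializationAt F A p₀) p hp m (α p)
    simp only [ContinuousLinearMap.inCoordinates]
    change (trivializationAt ℝ (Bundle.Trivial M ℝ) p₀).linearMapAt ℝ p (hullPoint E F V (α p)
      ((trivializationAt (AffineDualModel F) (AffineDual E F V A) p₀).symmL ℝ p m)) = _
    rw [Trivialization.symmL_apply _ hp', h1,
      Trivialization.coe_linearMapAt_of_mem _ (mem_univ p)]
    exact h2⟩
end AffineSections

section LocalFrames

variable {E : Type*} [NormedAddCommGroup E] [NormedSpace ℝ E] [FiniteDimensional ℝ E]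
  {M : Type*} [TopologicalSpace M] [ChartedSpace E M] [IsManifold 𝓘(ℝ, E) ∞ M] [T2Space M]
  {F : Type*} [NormedAddCommGroup F] [NormedSpace ℝ F] [FiniteDimensional ℝ F]
  {V : M → Type*} [∀ p, AddCommGroup (V p)] [∀ p, Module ℝ (V p)]
  [∀ p, TopologicalSpace (V p)] [TopologicalSpace (TotalSpace F V)]
  [FiberBundle F V] [VectorBundle ℝ F V] [ContMDiffVectorBundle ∞ F V 𝓘(ℝ, E)]

/-- The local representative of a section near `p`. -/
def Sec.coord (X : Sec E F V) (p q : M) : F := (trivializationAt F V p ⟨q, X q⟩).2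

lemma Sec.contMDiffOn_coord (X : Sec E F V) (p : M) :
    ContMDiffOn 𝓘(ℝ, E) 𝓘(ℝ, F) ∞ (X.coord p) (trivializationAt F V p).baseSet :=
  ((trivializationAt F V p).contMDiffOn_section_baseSet_iff).1 X.contMDiff.contMDiffOn

lemma Sec.mdifferentiableAt_coord (X : Sec E F V) (p : M) :
    MDifferentiableAt 𝓘(ℝ, E) 𝓘(ℝ, F) (X.coord p) p :=
  ((X.contMDiffOn_coord p).contMDiffAt ((trivializationAt F V p).open_baseSet.mem_nhds
    (mem_baseSet_trivializationAt F V p))).mdifferentiableAt (by simp)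

lemma exists_bump (p : M) (u : Set M) (hu : u ∈ 𝓝 p) : ∃ b : C^∞⟮𝓘(ℝ, E), M; ℝ⟯,
    b =ᶠ[𝓝 p] 1 ∧ tsupport b ⊆ u := by
  obtain ⟨b, hb⟩ := ((SmoothBumpFunction.nhds_basis_support (I := 𝓘(ℝ, E)) hu).ex_mem)
  exact ⟨⟨b, b.contMDiff⟩, b.eventuallyEq_one, hb⟩

lemma hasMFDerivAt_bundle_proj (z : TotalSpace F V) :
    HasMFDerivAt (𝓘(ℝ, E).prod 𝓘(ℝ, F)) 𝓘(ℝ, E) (π F V) z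
      (ContinuousLinearMap.fst ℝ E F : E × F →L[ℝ] E) := by
  refine ⟨(FiberBundle.continuous_proj F V).continuousAt, ?_⟩
  have key : ∀ y ∈ (extChartAt (𝓘(ℝ, E).prod 𝓘(ℝ, F)) z).target,
      writtenInExtChartAt (𝓘(ℝ, E).prod 𝓘(ℝ, F)) 𝓘(ℝ, E) z (π F V) y = y.1 := by
    intro y hy
    rw [FiberBundle.extChartAt_target] at hy
    have h1 : ((extChartAt (𝓘(ℝ, E).prod 𝓘(ℝ, F)) z).symm y).proj =
        (extChartAt 𝓘(ℝ, E) z.proj).symm y.1 := by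
      rw [FiberBundle.extChartAt]
      exact (trivializationAt F V z.proj).proj_symm_apply' hy.1.2
    rw [writtenInExtChartAt, Function.comp_apply, Function.comp_apply, h1]
    exact (extChartAt 𝓘(ℝ, E) z.proj).right_inv hy.1.1
  refine (hasFDerivAt_fst (p := extChartAt (𝓘(ℝ, E).prod 𝓘(ℝ, F)) z z)).hasFDerivWithinAt
    |>.congr_of_eventuallyEq ?_ (key _ (mem_extChartAt_target z))
  filter_upwards [extChartAt_target_mem_nhdsWithin (I := 𝓘(ℝ, E).prod 𝓘(ℝ, F)) z] with y hy
    using key y hy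

lemma hasMFDerivAt_bundle_snd (z : TotalSpace F V) :
    HasMFDerivAt (𝓘(ℝ, E).prod 𝓘(ℝ, F)) 𝓘(ℝ, F) (fun y => (trivializationAt F V z.1 y).2) z
      (ContinuousLinearMap.snd ℝ E F : E × F →L[ℝ] F) := by
  refine ⟨?_, ?_⟩
  · exact continuous_snd.continuousAt.comp ((trivializationAt F V z.1).continuousAt
      ((trivializationAt F V z.1).mem_source.2 (mem_baseSet_trivializationAt F V z.1)))
  have key : ∀ y ∈ (extChartAt (𝓘(ℝ, E).prod 𝓘(ℝ, F)) z).target,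
      writtenInExtChartAt (𝓘(ℝ, E).prod 𝓘(ℝ, F)) 𝓘(ℝ, F) z
        (fun y => (trivializationAt F V z.1 y).2) y = y.2 := by
    intro y hy
    rw [FiberBundle.extChartAt_target] at hy
    rw [writtenInExtChartAt, Function.comp_apply, Function.comp_apply, FiberBundle.extChartAt]
    exact congrArg Prod.snd ((trivializationAt F V z.proj).apply_symm_apply' (x := y.2) hy.1.2)
  refine (hasFDerivAt_snd (p := extChartAt (𝓘(ℝ, E).prod 𝓘(ℝ, F)) z z)).hasFDerivWithinAt
    |>.congr_of_eventuallyEq ?_ (key _ (mem_extChartAt_target z))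
  filter_upwards [extChartAt_target_mem_nhdsWithin (I := 𝓘(ℝ, E).prod 𝓘(ℝ, F)) z] with y hy
    using key y hy

lemma exists_frame (p : M) : ∃ S : F →ₗ[ℝ] Sec E F V,
    (∀ v, ∀ᶠ q in 𝓝 p, (S v).coord p q = v) ∧
    ∀ (L : LieAlgebroid E F V) (Y X : Sec E F V),
      L.bracket Y X p = L.bracket Y (S (X.coord p p)) p +
        (trivializationAt F V p).symmₗ ℝ p
          (mfderiv 𝓘(ℝ, E) 𝓘(ℝ, F) (X.coord p) p (L.anchor p (Y p))) := by
  set t := trivializationAt F V p with ht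
  have hp : p ∈ t.baseSet := mem_baseSet_trivializationAt F V p
  have hpn : t.baseSet ∈ 𝓝 p := t.open_baseSet.mem_nhds hp
  obtain ⟨b, hb1, hb⟩ := exists_bump (E := E) p t.baseSet hpn
  have hbp : b p = 1 := hb1.eq_of_nhds
  have hts : ∀ q ∈ t.baseSet, ∀ v, t ⟨q, t.symmₗ ℝ q v⟩ = (q, v) := fun q hq v => by
    rw [t.symmₗ_apply hq, t.mk_symm hq, t.apply_symm_apply' hq]
  have hst : ∀ q ∈ t.baseSet, ∀ v : V q, t.symmₗ ℝ q (t ⟨q, v⟩).2 = v := fun q hq v => by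
    have := t.symmₗ_linearMapAt (R := ℝ) hq v
    rwa [t.coe_linearMapAt_of_mem hq] at this
  have hsm : ∀ v : F, ContMDiffOn 𝓘(ℝ, E) (𝓘(ℝ, E).prod 𝓘(ℝ, F)) ∞
      (fun q => TotalSpace.mk' F q (t.symmₗ ℝ q v)) t.baseSet := by
    intro v
    rw [t.contMDiffOn_section_baseSet_iff]
    refine (contMDiffOn_const (c := v)).congr fun q hq => ?_
    rw [hts q hq]
  let S : F →ₗ[ℝ] Sec E F V :=
    { toFun := fun v => ⟨fun q => b q • t.symmₗ ℝ q v,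
        ContMDiffOn.smul_section_of_tsupport b.contMDiff.contMDiffOn t.open_baseSet hb (hsm v)⟩
      map_add' := fun v w => by
        ext q
        change b q • t.symmₗ ℝ q (v + w) = b q • t.symmₗ ℝ q v + b q • t.symmₗ ℝ q w
        rw [map_add, smul_add]
      map_smul' := fun r v => by
        ext q
        change b q • t.symmₗ ℝ q (r • v) = r • b q • t.symmₗ ℝ q v
        rw [map_smul, smul_comm] }
  have hS : ∀ v q, S v q = b q • t.symmₗ ℝ q v := fun v q => rfl
  refine ⟨S, fun v => ?_, fun L Y X => ?_⟩
  · filter_upwards [hb1, hpn] with q hq hqt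
    change (t ⟨q, b q • t.symmₗ ℝ q v⟩).2 = v
    rw [hq, Pi.one_apply, one_smul, hts q hqt]
  · let B := Module.finBasis ℝ F
    have hdX := X.mdifferentiableAt_coord p
    have hsf : ∀ i, ContMDiff 𝓘(ℝ, E) 𝓘(ℝ, ℝ) ∞ (fun q => b q * B.coord i (X.coord p q)) := by
      intro i
      refine contMDiff_of_tsupport fun q hq => ?_
      have hqt : t.baseSet ∈ 𝓝 q := t.open_baseSet.mem_nhds (hb (tsupport_mul_subset_left hq))
      have h1 : ContMDiff 𝓘(ℝ, F) 𝓘(ℝ, ℝ) ∞ (LinearMap.toContinuousLinearMap (B.coord i)) :=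
        ContinuousLinearMap.contMDiff _
      exact b.contMDiff.contMDiffAt.mul
        (h1.contMDiffAt.comp q ((X.contMDiffOn_coord p).contMDiffAt hqt))
    let f : Fin _ → C^∞⟮𝓘(ℝ, E), M; ℝ⟯ := fun i => ⟨_, hsf i⟩
    have hf : ∀ i q, f i q = b q * B.coord i (X.coord p q) := fun _ _ => rfl
    have hsum : ∀ (s : Finset (Fin (Module.finrank ℝ F))) (Z : Fin (Module.finrank ℝ F) → Sec E F V)
        (q : M), (∑ i ∈ s, Z i) q = ∑ i ∈ s, Z i q := fun s Z q => by
      have := congrFun (map_sum (ContMDiffSection.coeAddHom 𝓘(ℝ, E) F ∞ V) Z s) q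
      rw [Finset.sum_apply] at this
      exact this
    have key : X.fsmul (b * b) = ∑ i, (S (B i)).fsmul (f i) := by
      ext q
      rw [hsum]
      change (b q * b q) • X q = ∑ i, f i q • S (B i) q
      by_cases hq : q ∈ t.baseSet
      · have h1 : X q = ∑ i, B.coord i (X.coord p q) • t.symmₗ ℝ q (B i) := by
          rw [← hst q hq (X q)]
          simp_rw [← map_smul, ← map_sum]
          congr 1
          exact (B.sum_repr _).symm
        rw [h1, Finset.smul_sum]
        refine Finset.sum_congr rfl fun i _ => ?_
        rw [hf, hS, smul_smul, smul_smul]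
        congr 1
        ring
      · have : b q = 0 := image_eq_zero_of_notMem_tsupport fun h => hq (hb h)
        simp [hf, this]
    have h1 : L.bracket Y (X.fsmul (b * b)) p = L.bracket Y X p := by
      have hd : differential 𝓘(ℝ, E) (b * b : C^∞⟮𝓘(ℝ, E), M; ℝ⟯) p = 0 := by
        have : (⇑(b * b : C^∞⟮𝓘(ℝ, E), M; ℝ⟯)) =ᶠ[𝓝 p] fun _ => (1 : ℝ) := by
          filter_upwards [hb1] with q hq
          simp [hq]
        unfold differential
        rw [this.mfderiv_eq]
        exact mfderiv_const
      rw [L.leibniz, hd]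
      simp [hbp]
    have h2 : ∀ i, L.bracket Y ((S (B i)).fsmul (f i)) p =
        B.coord i (X.coord p p) • L.bracket Y (S (B i)) p + B.coord i
          (mfderiv 𝓘(ℝ, E) 𝓘(ℝ, F) (X.coord p) p (L.anchor p (Y p)) : F) • t.symmₗ ℝ p (B i) := by
      intro i
      have hd : differential 𝓘(ℝ, E) (f i) p (L.anchor p (Y p)) = B.coord i
          (mfderiv 𝓘(ℝ, E) 𝓘(ℝ, F) (X.coord p) p (L.anchor p (Y p)) : F) := by
        have : (f i) =ᶠ[𝓝 p] (LinearMap.toContinuousLinearMap (B.coord i)) ∘ (X.coord p) := by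
          filter_upwards [hb1] with q hq
          simp [hf, hq]
        unfold differential
        rw [this.mfderiv_eq]
        have h3 := (LinearMap.toContinuousLinearMap (B.coord i)).hasMFDerivAt
          (x := X.coord p p)
        rw [(h3.comp p hdX.hasMFDerivAt).mfderiv]
        rfl
      rw [L.leibniz, hd, hf, hS, hbp]
      simp
    rw [← h1, key, map_sum, hsum]
    simp_rw [h2]
    rw [Finset.sum_add_distrib]
    congr 1
    · have h3 : S (X.coord p p) = ∑ i, B.coord i (X.coord p p) • S (B i) := by
        simp_rw [← map_smul, ← map_sum]
        congr 1
        exact (B.sum_repr _).symm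
      rw [h3, map_sum, hsum]
      refine Finset.sum_congr rfl fun i _ => ?_
      rw [map_smul]
      rfl
    · simp_rw [← map_smul, ← map_sum]
      congr 1
      exact B.sum_repr _

end LocalFrames

section PoissonAndCompleteLift

variable {E : Type*} [NormedAddCommGroup E] [NormedSpace ℝ E] [FiniteDimensional ℝ E]
  {M : Type*} [TopologicalSpace M] [ChartedSpace E M] [IsManifold 𝓘(ℝ, E) ∞ M] [T2Space M]
  {F : Type*} [NormedAddCommGroup F] [NormedSpace ℝ F] [FiniteDimensional ℝ F]
  {W : M → Type*} [∀ p, AddCommGroup (W p)] [∀ p, Module ℝ (W p)]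
  [∀ p, TopologicalSpace (W p)] [TopologicalSpace (TotalSpace F W)]
  [FiberBundle F W] [VectorBundle ℝ F W] [ContMDiffVectorBundle ∞ F W 𝓘(ℝ, E)]

lemma exists_differential_eq (p : M) (h : E →L[ℝ] ℝ) :
    ∃ f : C^∞⟮𝓘(ℝ, E), M; ℝ⟯, differential 𝓘(ℝ, E) f p = h := by
  obtain ⟨b, hb1, hb⟩ := exists_bump (E := E) p (chartAt E p).source (chart_source_mem_nhds E p)
  have hs : ContMDiff 𝓘(ℝ, E) 𝓘(ℝ, ℝ) ∞ (fun q => b q * h (extChartAt 𝓘(ℝ, E) p q)) := by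
    refine contMDiff_of_tsupport fun q hq => ?_
    have hq' := hb (tsupport_mul_subset_left hq)
    exact b.contMDiff.contMDiffAt.mul (h.contMDiff.contMDiffAt.comp q (contMDiffAt_extChartAt' hq'))
  refine ⟨⟨_, hs⟩, ?_⟩
  have h1 : (fun q => b q * h (extChartAt 𝓘(ℝ, E) p q)) =ᶠ[𝓝 p] h ∘ extChartAt 𝓘(ℝ, E) p := by
    filter_upwards [hb1] with q hq
    simp [hq]
  have h2 : HasMFDerivAt 𝓘(ℝ, E) 𝓘(ℝ, E) (extChartAt 𝓘(ℝ, E) p) p (ContinuousLinearMap.id ℝ E) := by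
    refine ⟨continuousAt_extChartAt p, ?_⟩
    have key : ∀ y ∈ (extChartAt 𝓘(ℝ, E) p).target,
        writtenInExtChartAt 𝓘(ℝ, E) 𝓘(ℝ, E) p (extChartAt 𝓘(ℝ, E) p) y = y := fun y hy =>
      (extChartAt 𝓘(ℝ, E) p).right_inv hy
    refine (hasFDerivAt_id _).hasFDerivWithinAt.congr_of_eventuallyEq ?_
      (key _ (mem_extChartAt_target p))
    filter_upwards [extChartAt_target_mem_nhdsWithin (I := 𝓘(ℝ, E)) p] with y hy using key y hy
  change mfderiv 𝓘(ℝ, E) 𝓘(ℝ, ℝ) (fun q => b q * h (extChartAt 𝓘(ℝ, E) p q)) p = h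
  rw [h1.mfderiv_eq]
  exact ((h.hasMFDerivAt).comp p h2).mfderiv

lemma hasMFDerivAt_clm_apply {B H N : Type*} [NormedAddCommGroup B] [NormedSpace ℝ B]
    [TopologicalSpace H] {I : ModelWithCorners ℝ B H} [TopologicalSpace N] [ChartedSpace H N]
    {c : N → F →L[ℝ] ℝ} {τ : N → F} {x : N} {c' : TangentSpace I x →L[ℝ] (F →L[ℝ] ℝ)}
    {τ' : TangentSpace I x →L[ℝ] F} (hc : HasMFDerivAt I 𝓘(ℝ, F →L[ℝ] ℝ) c x c')
    (hτ : HasMFDerivAt I 𝓘(ℝ, F) τ x τ') (v : TangentSpace I x) :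
    differential I (fun y => c y (τ y)) x v = c' v (τ x) + c x (τ' v) := by
  have hc2 : HasFDerivWithinAt (c ∘ (extChartAt I x).symm) (c' : B →L[ℝ] (F →L[ℝ] ℝ))
    (range I) (extChartAt I x x) := hc.2
  have hτ2 : HasFDerivWithinAt (τ ∘ (extChartAt I x).symm) (τ' : B →L[ℝ] F)
    (range I) (extChartAt I x x) := hτ.2
  have h3 := hc2.clm_apply hτ2
  have h4 : HasMFDerivAt I 𝓘(ℝ, ℝ) (fun y => c y (τ y)) x _ := ⟨hc.1.clm_apply hτ.1, h3⟩
  unfold differential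
  rw [h4.mfderiv, add_comm (c' v (τ x))]
  have h5 : (extChartAt I x).symm (extChartAt I x x) = x := extChartAt_to_inv x
  simp only [Function.comp_apply, h5]
  rfl

/-- The differential at `p` of the local representative of a section near `p`. -/
def Sec.dcoord (X : Sec E F W) (p : M) : E →L[ℝ] F := mfderiv 𝓘(ℝ, E) 𝓘(ℝ, F) (X.coord p) p

lemma dual_apply_eq {p q : M} (hq : q ∈ (trivializationAt F W p).baseSet) (φ : DualBundle W q)
    (v : W q) : (φ v : ℝ) =
      (trivializationAt (F →L[ℝ] ℝ) (DualBundle W) p ⟨q, φ⟩).2 (trivializationAt F W p ⟨q, v⟩).2 := by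
  rw [hom_trivializationAt_apply]
  simp only [ContinuousLinearMap.inCoordinates]
  change _ = (trivializationAt ℝ (Bundle.Trivial M ℝ) p).linearMapAt ℝ q
    (φ ((trivializationAt F W p).symmL ℝ q (trivializationAt F W p ⟨q, v⟩).2))
  rw [Trivialization.coe_linearMapAt_of_mem _ (mem_univ q)]
  have := (trivializationAt F W p).symmₗ_linearMapAt (R := ℝ) hq v
  rw [Trivialization.coe_linearMapAt_of_mem _ hq] at this
  change _ = φ ((trivializationAt F W p).symmₗ ℝ q (trivializationAt F W p ⟨q, v⟩).2)
  rw [this]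

lemma differential_comp_proj (f : C^∞⟮𝓘(ℝ, E), M; ℝ⟯) (w : TotalSpace F W) (v : E × F) :
    differential (𝓘(ℝ, E).prod 𝓘(ℝ, F)) (f ∘ π F W) w v = differential 𝓘(ℝ, E) f w.1 v.1 := by
  have hf : MDifferentiableAt 𝓘(ℝ, E) 𝓘(ℝ, ℝ) f w.1 := f.contMDiff.mdifferentiable (by simp) _
  unfold differential
  rw [(hf.hasMFDerivAt.comp w (hasMFDerivAt_bundle_proj w)).mfderiv]
  rfl

lemma differential_linearFun (X : Sec E (F →L[ℝ] ℝ) (DualBundle W)) (w : TotalSpace F W)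
    (v : E × F) : differential (𝓘(ℝ, E).prod 𝓘(ℝ, F)) (linearFun X) w v =
      X.dcoord w.1 v.1 (trivializationAt F W w.1 w).2 + X.coord w.1 w.1 v.2 := by
  have h1 : linearFun X =ᶠ[𝓝 w]
      fun z => (X.coord w.1 ∘ π F W) z (trivializationAt F W w.1 z).2 := by
    have : π F W ⁻¹' (trivializationAt F W w.1).baseSet ∈ 𝓝 w :=
      (FiberBundle.continuous_proj F W).continuousAt.preimage_mem_nhds
        ((trivializationAt F W w.1).open_baseSet.mem_nhds (mem_baseSet_trivializationAt F W w.1))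
    filter_upwards [this] with z hz using dual_apply_eq hz _ _
  have h2 := hasMFDerivAt_clm_apply
    ((X.mdifferentiableAt_coord w.1).hasMFDerivAt.comp w (hasMFDerivAt_bundle_proj w))
    (hasMFDerivAt_bundle_snd w) v
  unfold differential at h2 ⊢
  rw [h1.mfderiv_eq]
  exact h2

lemma differential_linearFunDual (μ : Sec E F W) (e : TotalSpace (F →L[ℝ] ℝ) (DualBundle W))
    (v : E × (F →L[ℝ] ℝ)) :
    differential (𝓘(ℝ, E).prod 𝓘(ℝ, F →L[ℝ] ℝ)) (linearFunDual μ) e v =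
      v.2 (μ.coord e.1 e.1) + (trivializationAt (F →L[ℝ] ℝ) (DualBundle W) e.1 e).2
        (μ.dcoord e.1 v.1) := by
  have h1 : linearFunDual μ =ᶠ[𝓝 e] fun z =>
      (trivializationAt (F →L[ℝ] ℝ) (DualBundle W) e.1 z).2 ((μ.coord e.1 ∘ π _ _) z) := by
    have : π _ _ ⁻¹' (trivializationAt F W e.1).baseSet ∈ 𝓝 e :=
      (FiberBundle.continuous_proj (F →L[ℝ] ℝ) (DualBundle W)).continuousAt.preimage_mem_nhds
        ((trivializationAt F W e.1).open_baseSet.mem_nhds (mem_baseSet_trivializationAt F W e.1))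
    filter_upwards [this] with z hz using dual_apply_eq hz _ _
  have h2 := hasMFDerivAt_clm_apply (hasMFDerivAt_bundle_snd e)
    ((μ.mdifferentiableAt_coord e.1).hasMFDerivAt.comp e (hasMFDerivAt_bundle_proj e)) v
  unfold differential at h2 ⊢
  rw [h1.mfderiv_eq]
  exact h2

lemma differential_pairing (μ : Sec E F W) (X : Sec E (F →L[ℝ] ℝ) (DualBundle W)) (p : M) (v : E) :
    differential 𝓘(ℝ, E) (pairing μ X) p v =
      X.dcoord p v (μ.coord p p) +
        X.coord p p (μ.dcoord p v) := by
  have h1 : pairing μ X =ᶠ[𝓝 p] fun q => X.coord p q (μ.coord p q) := by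
    filter_upwards [(trivializationAt F W p).open_baseSet.mem_nhds
      (mem_baseSet_trivializationAt F W p)] with q hq using dual_apply_eq hq _ _
  have h2 := hasMFDerivAt_clm_apply (X.mdifferentiableAt_coord p).hasMFDerivAt
    (μ.mdifferentiableAt_coord p).hasMFDerivAt v
  unfold differential at h2 ⊢
  rw [h1.mfderiv_eq]
  exact h2

end PoissonAndCompleteLift

section PoissonAndCompleteLift

variable {E : Type*} [NormedAddCommGroup E] [NormedSpace ℝ E] [FiniteDimensional ℝ E]
  {M : Type*} [TopologicalSpace M] [ChartedSpace E M] [IsManifold 𝓘(ℝ, E) ∞ M] [T2Space M]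
  {F : Type*} [NormedAddCommGroup F] [NormedSpace ℝ F] [FiniteDimensional ℝ F]
  {W : M → Type*} [∀ p, AddCommGroup (W p)] [∀ p, Module ℝ (W p)]
  [∀ p, TopologicalSpace (W p)] [TopologicalSpace (TotalSpace F W)]
  [FiberBundle F W] [VectorBundle ℝ F W] [ContMDiffVectorBundle ∞ F W 𝓘(ℝ, E)]

/-- The cotangent space at a point of a manifold. -/
abbrev Cotangent {B H N : Type*} [NormedAddCommGroup B] [NormedSpace ℝ B] [TopologicalSpace H]
    (I : ModelWithCorners ℝ B H) [TopologicalSpace N] [ChartedSpace H N] (x : N) : Type _ :=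
  TangentSpace I x →L[ℝ] ℝ

variable (L : LieAlgebroid E (F →L[ℝ] ℝ) (DualBundle W))

/-- The values at the point `w ∈ W` of the linear Poisson tensor of a Lie algebroid `W*`:
`{ι_X, ι_Y} = ι_[X,Y]`, `{ι_X, f ∘ π} = ρ(X)(f) ∘ π` and `{f ∘ π, g ∘ π} = 0`. -/
structure IsLinearPoissonAt (w : TotalSpace F W)
    (Λ : Cotangent (𝓘(ℝ, E).prod 𝓘(ℝ, F)) w →ₗ[ℝ]
      Cotangent (𝓘(ℝ, E).prod 𝓘(ℝ, F)) w →ₗ[ℝ] ℝ) : Prop where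
  alternating : ∀ ξ, Λ ξ ξ = 0
  linear_linear : ∀ X Y : Sec E (F →L[ℝ] ℝ) (DualBundle W),
    Λ (differential (𝓘(ℝ, E).prod 𝓘(ℝ, F)) (linearFun X) w)
    (differential (𝓘(ℝ, E).prod 𝓘(ℝ, F)) (linearFun Y) w) = linearFun (L.bracket X Y) w
  linear_basic : ∀ (X : Sec E (F →L[ℝ] ℝ) (DualBundle W)) (f : C^∞⟮𝓘(ℝ, E), M; ℝ⟯),
    Λ (differential (𝓘(ℝ, E).prod 𝓘(ℝ, F)) (linearFun X) w)
      (differential (𝓘(ℝ, E).prod 𝓘(ℝ, F)) (f ∘ π F W) w) =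
        differential 𝓘(ℝ, E) f w.1 (L.anchor w.1 (X w.1))
  basic_basic : ∀ f g : C^∞⟮𝓘(ℝ, E), M; ℝ⟯,
    Λ (differential (𝓘(ℝ, E).prod 𝓘(ℝ, F)) (f ∘ π F W) w)
      (differential (𝓘(ℝ, E).prod 𝓘(ℝ, F)) (g ∘ π F W) w) = 0

/-- The Lie derivative of the 1-form `μ` along `X`, evaluated on `Y`. -/
def lieDeriv₁ (X : Sec E (F →L[ℝ] ℝ) (DualBundle W)) (μ : Sec E F W)
    (Y : Sec E (F →L[ℝ] ℝ) (DualBundle W)) (p : M) : ℝ :=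
  differential 𝓘(ℝ, E) (pairing μ Y) p (L.anchor p (X p)) - pairing μ (L.bracket X Y) p

/-- The value `v` at the point `e ∈ W*` of the complete lift `X^c` of a section `X` of the Lie
algebroid `W*`: `X^c(f ∘ π) = ρ(X)(f) ∘ π` and `X^c(ι_μ) = ι_(L_X μ)`. -/
structure IsCompleteLiftAt (X : Sec E (F →L[ℝ] ℝ) (DualBundle W))
    (e : TotalSpace (F →L[ℝ] ℝ) (DualBundle W))
    (v : TangentSpace (𝓘(ℝ, E).prod 𝓘(ℝ, F →L[ℝ] ℝ)) e) : Prop where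
  basic : ∀ f : C^∞⟮𝓘(ℝ, E), M; ℝ⟯,
    differential (𝓘(ℝ, E).prod 𝓘(ℝ, F →L[ℝ] ℝ)) (f ∘ π (F →L[ℝ] ℝ) (DualBundle W)) e v =
      differential 𝓘(ℝ, E) f e.1 (L.anchor e.1 (X e.1))
  linear : ∀ (μ : Sec E F W) (Y : Sec E (F →L[ℝ] ℝ) (DualBundle W)), Y e.1 = e.2 →
    differential (𝓘(ℝ, E).prod 𝓘(ℝ, F →L[ℝ] ℝ)) (linearFunDual μ) e v = lieDeriv₁ L X μ Y e.1

lemma coord_injective {F : Type*} [NormedAddCommGroup F] [NormedSpace ℝ F] {V : M → Type*}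
    [∀ p, AddCommGroup (V p)] [∀ p, Module ℝ (V p)]
    [∀ p, TopologicalSpace (V p)] [TopologicalSpace (TotalSpace F V)]
    [FiberBundle F V] [VectorBundle ℝ F V] {p : M} {v w : V p}
    (h : (trivializationAt F V p ⟨p, v⟩).2 = (trivializationAt F V p ⟨p, w⟩).2) : v = w :=
  (fiberEquiv (trivializationAt F V p) p (mem_baseSet_trivializationAt F V p)).injective h

lemma dual_symm_apply {p : M} (γ : F →L[ℝ] ℝ) (v : W p) :
    ((trivializationAt (F →L[ℝ] ℝ) (DualBundle W) p).symmₗ ℝ p γ v : ℝ) =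
      γ (trivializationAt F W p ⟨p, v⟩).2 := by
  have hp := mem_baseSet_trivializationAt (F →L[ℝ] ℝ) (DualBundle W) p
  rw [dual_apply_eq (mem_baseSet_trivializationAt F W p), Trivialization.symmₗ_apply _ hp,
    Trivialization.mk_symm _ hp, Trivialization.apply_symm_apply' _ hp]

set_option maxHeartbeats 1000000 in
theorem existsUnique_isLinearPoissonAt (w : TotalSpace F W) : ∃! Λ, IsLinearPoissonAt L w Λ := by
  obtain ⟨p, w₀⟩ := w
  obtain ⟨S, hS, hB⟩ := exists_frame (E := E) (F := F →L[ℝ] ℝ) (V := DualBundle W) p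
  have hSp : ∀ γ, (S γ).coord p p = γ := fun γ => (hS γ).self_of_nhds
  have hSd : ∀ γ, (S γ).dcoord p = 0 := fun γ => by
    have : (S γ).coord p =ᶠ[𝓝 p] fun _ => γ := hS γ
    unfold Sec.dcoord
    rw [this.mfderiv_eq]
    exact mfderiv_const
  have hSX : ∀ X : Sec E (F →L[ℝ] ℝ) (DualBundle W), S (X.coord p p) p = X p := fun X =>
    coord_injective (hSp _)
  set g₀ := (trivializationAt F W p ⟨p, w₀⟩).2 with hg₀
  have hB1 : ∀ Y X, L.bracket Y X p w₀ =
      L.bracket Y (S (X.coord p p)) p w₀ + X.dcoord p (L.anchor p (Y p)) g₀ := fun Y X => by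
    refine (congrArg (fun φ : DualBundle W p => (φ w₀ : ℝ)) (hB L Y X)).trans ?_
    exact congrArg _ (dual_symm_apply (X.dcoord p (L.anchor p (Y p))) w₀)
  have hsk : ∀ X Y, L.bracket X Y p w₀ = -(L.bracket Y X p w₀) := fun X Y => by
    rw [L.bracket_skew X Y]
    rfl
  have hB2 : ∀ X Y, L.bracket X Y p w₀ =
      L.bracket (S (X.coord p p)) (S (Y.coord p p)) p w₀ + Y.dcoord p (L.anchor p (X p)) g₀ -
        X.dcoord p (L.anchor p (Y p)) g₀ := fun X Y => by
    rw [hB1 X Y, hsk X, hB1 (S _) X, hsk (S (X.coord p p)), hSX]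
    ring
  let vert : (E × F →L[ℝ] ℝ) →ₗ[ℝ] (F →L[ℝ] ℝ) :=
    { toFun := fun ξ => ξ ∘L ContinuousLinearMap.inr ℝ E F
      map_add' := fun _ _ => rfl
      map_smul' := fun _ _ => rfl }
  let hor : (E × F →L[ℝ] ℝ) →ₗ[ℝ] (E →L[ℝ] ℝ) :=
    { toFun := fun ξ => ξ ∘L ContinuousLinearMap.inl ℝ E F
      map_add' := fun _ _ => rfl
      map_smul' := fun _ _ => rfl }
  let ρ : (F →L[ℝ] ℝ) → E := fun γ => L.anchor p (S γ p)
  have hρa : ∀ γ δ, ρ (γ + δ) = ρ γ + ρ δ := fun γ δ => by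
    change L.anchor p (S (γ + δ) p) = _
    rw [map_add]
    exact map_add (L.anchor p) _ _
  have hρs : ∀ (r : ℝ) γ, ρ (r • γ) = r • ρ γ := fun r γ => by
    change L.anchor p (S (r • γ) p) = _
    rw [map_smul]
    exact map_smul (L.anchor p) _ _
  let Λ : (E × F →L[ℝ] ℝ) →ₗ[ℝ] (E × F →L[ℝ] ℝ) →ₗ[ℝ] ℝ := LinearMap.mk₂ ℝ
    (fun ξ η => (L.bracket (S (vert ξ)) (S (vert η)) p w₀ : ℝ) + hor η (ρ (vert ξ)) -
      hor ξ (ρ (vert η)))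
    (fun ξ ξ' η => by
      simp only [map_add, hρa, LinearMap.add_apply, ContMDiffSection.coe_add, Pi.add_apply,
        _root_.add_apply]
      ring)
    (fun r ξ η => by
      simp only [map_smul, hρs, LinearMap.smul_apply, ContMDiffSection.coe_smul, Pi.smul_apply,
        _root_.smul_apply, smul_eq_mul]
      ring)
    (fun ξ η η' => by
      simp only [map_add, hρa, ContMDiffSection.coe_add, Pi.add_apply,
        _root_.add_apply]
      ring)
    (fun r ξ η => by
      simp only [map_smul, hρs, ContMDiffSection.coe_smul, Pi.smul_apply,
        _root_.smul_apply, smul_eq_mul]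
      ring)
  have hΛ : ∀ ξ η, Λ ξ η = (L.bracket (S (vert ξ)) (S (vert η)) p w₀ : ℝ) + hor η (ρ (vert ξ)) -
      hor ξ (ρ (vert η)) := fun _ _ => rfl
  have hvX : ∀ X : Sec E (F →L[ℝ] ℝ) (DualBundle W),
      vert (differential (𝓘(ℝ, E).prod 𝓘(ℝ, F)) (linearFun X) (⟨p, w₀⟩ : TotalSpace F W)) =
        X.coord p p := fun X => by
    ext g
    refine (differential_linearFun X (⟨p, w₀⟩ : TotalSpace F W) (0, g)).trans ?_
    simp
  have hhX : ∀ (X : Sec E (F →L[ℝ] ℝ) (DualBundle W)) (u : E),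
      hor (differential (𝓘(ℝ, E).prod 𝓘(ℝ, F)) (linearFun X) (⟨p, w₀⟩ : TotalSpace F W)) u =
        X.dcoord p u g₀ := fun X u => by
    refine (differential_linearFun X (⟨p, w₀⟩ : TotalSpace F W) (u, 0)).trans ?_
    simp [hg₀]
  have hvf : ∀ f : C^∞⟮𝓘(ℝ, E), M; ℝ⟯,
      vert (differential (𝓘(ℝ, E).prod 𝓘(ℝ, F)) (f ∘ π F W) (⟨p, w₀⟩ : TotalSpace F W)) = 0 :=
    fun f => by
      ext g
      refine (differential_comp_proj f (⟨p, w₀⟩ : TotalSpace F W) (0, g)).trans ?_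
      exact map_zero (differential 𝓘(ℝ, E) f p)
  have hhf : ∀ (f : C^∞⟮𝓘(ℝ, E), M; ℝ⟯) (u : E),
      hor (differential (𝓘(ℝ, E).prod 𝓘(ℝ, F)) (f ∘ π F W) (⟨p, w₀⟩ : TotalSpace F W)) u =
        differential 𝓘(ℝ, E) f p u :=
    fun f u => differential_comp_proj f (⟨p, w₀⟩ : TotalSpace F W) (u, 0)
  have hρX : ∀ X : Sec E (F →L[ℝ] ℝ) (DualBundle W), ρ (X.coord p p) = L.anchor p (X p) :=
    fun X => congrArg (L.anchor p) (hSX X)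
  have hρ0 : ρ 0 = 0 := by
    have := hρs 0 0
    simpa using this
  have hrep : ∀ ξ : E × F →L[ℝ] ℝ, ∃ (X : Sec E (F →L[ℝ] ℝ) (DualBundle W))
      (f : C^∞⟮𝓘(ℝ, E), M; ℝ⟯), ξ =
        differential (𝓘(ℝ, E).prod 𝓘(ℝ, F)) (linearFun X) (⟨p, w₀⟩ : TotalSpace F W) +
        differential (𝓘(ℝ, E).prod 𝓘(ℝ, F)) (f ∘ π F W) (⟨p, w₀⟩ : TotalSpace F W) := fun ξ => by
    obtain ⟨f, hf⟩ := exists_differential_eq (E := E) p (hor ξ)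
    refine ⟨S (vert ξ), f, ?_⟩
    refine ContinuousLinearMap.ext fun v => ?_
    change ξ v = differential (𝓘(ℝ, E).prod 𝓘(ℝ, F)) (linearFun _) (⟨p, w₀⟩ : TotalSpace F W) v +
      differential (𝓘(ℝ, E).prod 𝓘(ℝ, F)) (f ∘ π F W) (⟨p, w₀⟩ : TotalSpace F W) v
    rw [differential_linearFun, differential_comp_proj]
    simp only [hSd, hSp, hf]
    change ξ v = 0 + ξ (0, v.2) + ξ (v.1, 0)
    rw [zero_add, ← map_add]
    simp
  have hex : IsLinearPoissonAt L (⟨p, w₀⟩ : TotalSpace F W) Λ := by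
    refine ⟨fun ξ => ?_, fun X Y => ?_, fun X f => ?_, fun f g => ?_⟩
    · have := hsk (S (vert ξ)) (S (vert ξ))
      refine (hΛ ξ ξ).trans ?_
      have h0 : (L.bracket (S (vert ξ)) (S (vert ξ)) p w₀ : ℝ) = 0 := by linarith
      rw [h0]
      exact (add_sub_assoc _ _ _).trans (by rw [zero_add]; exact sub_self _)
    · refine (hΛ _ _).trans ?_
      rw [hvX, hvX, hhX, hhX, hρX, hρX]
      exact (hB2 X Y).symm
    · refine (hΛ _ _).trans ?_
      rw [hvX, hvf, hhX, hhf, hρX, hρ0]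
      simp
    · refine (hΛ _ _).trans ?_
      rw [hvf, hvf, hhf, hhf, hρ0]
      have h0 : ∀ h : C^∞⟮𝓘(ℝ, E), M; ℝ⟯, differential 𝓘(ℝ, E) h p (0 : E) = 0 := fun h =>
        map_zero (differential 𝓘(ℝ, E) h p)
      rw [h0, h0]
      simp
  refine ⟨Λ, hex, fun Λ' h' => ?_⟩
  have hneg : ∀ Λ₁ : (E × F →L[ℝ] ℝ) →ₗ[ℝ] (E × F →L[ℝ] ℝ) →ₗ[ℝ] ℝ, (∀ ξ, Λ₁ ξ ξ = 0) →
      ∀ ξ η, Λ₁ ξ η = -Λ₁ η ξ := fun Λ₁ h ξ η => by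
    have h1 := h (ξ + η)
    simp only [map_add, LinearMap.add_apply, h, zero_add, add_zero] at h1
    linarith
  refine LinearMap.ext fun ξ => LinearMap.ext fun η => ?_
  obtain ⟨X, f, rfl⟩ := hrep ξ
  obtain ⟨Y, g, rfl⟩ := hrep η
  have hsum : ∀ (Λ₁ : (E × F →L[ℝ] ℝ) →ₗ[ℝ] (E × F →L[ℝ] ℝ) →ₗ[ℝ] ℝ)
      (_ : IsLinearPoissonAt L (⟨p, w₀⟩ : TotalSpace F W) Λ₁),
      Λ₁ (differential (𝓘(ℝ, E).prod 𝓘(ℝ, F)) (linearFun X) (⟨p, w₀⟩ : TotalSpace F W) +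
          differential (𝓘(ℝ, E).prod 𝓘(ℝ, F)) (f ∘ π F W) (⟨p, w₀⟩ : TotalSpace F W))
        (differential (𝓘(ℝ, E).prod 𝓘(ℝ, F)) (linearFun Y) (⟨p, w₀⟩ : TotalSpace F W) +
          differential (𝓘(ℝ, E).prod 𝓘(ℝ, F)) (g ∘ π F W) (⟨p, w₀⟩ : TotalSpace F W)) =
      linearFun (L.bracket X Y) (⟨p, w₀⟩ : TotalSpace F W) +
        differential 𝓘(ℝ, E) g p (L.anchor p (X p)) -
        differential 𝓘(ℝ, E) f p (L.anchor p (Y p)) := fun Λ₁ h => by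
    have hbil : ∀ a b c d : E × F →L[ℝ] ℝ,
        Λ₁ (a + b) (c + d) = Λ₁ a c + Λ₁ a d - Λ₁ c b + Λ₁ b d := fun a b c d => by
      rw [hneg Λ₁ h.alternating c b]
      simp only [map_add, LinearMap.add_apply]
      ring
    refine (hbil _ _ _ _).trans ?_
    refine (congrArg₂ (· + ·) (congrArg₂ (· - ·) (congrArg₂ (· + ·) (h.linear_linear X Y)
      (h.linear_basic X g)) (h.linear_basic Y f)) (h.basic_basic f g)).trans ?_
    exact add_zero _
  exact (hsum Λ' h').trans (hsum Λ hex).symm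

theorem existsUnique_isCompleteLiftAt (X : Sec E (F →L[ℝ] ℝ) (DualBundle W))
    (e : TotalSpace (F →L[ℝ] ℝ) (DualBundle W)) : ∃! v, IsCompleteLiftAt L X e v := by
  obtain ⟨p, e₀⟩ := e
  obtain ⟨S, hS, hB⟩ := exists_frame (E := E) (F := F →L[ℝ] ℝ) (V := DualBundle W) p
  obtain ⟨T, hT, -⟩ := exists_frame (E := E) (F := F) (V := W) p
  have hTp : ∀ g, (T g).coord p p = g := fun g => (hT g).self_of_nhds
  set γ₀ := (trivializationAt (F →L[ℝ] ℝ) (DualBundle W) p ⟨p, e₀⟩).2 with hγ₀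
  have hS₀ : S γ₀ p = e₀ := coord_injective ((hS γ₀).self_of_nhds)
  let u : E := L.anchor p (X p)
  let γ : F →L[ℝ] ℝ := -(L.bracket X (S γ₀)).coord p p
  have key : ∀ (μ : Sec E F W) (Y : Sec E (F →L[ℝ] ℝ) (DualBundle W)), Y p = e₀ →
      lieDeriv₁ L X μ Y p = γ (μ.coord p p) + γ₀ (μ.dcoord p u) := by
    intro μ Y hY
    have h1 : Y.coord p p = γ₀ := by rw [Sec.coord, hY]
    have h2 : pairing μ (L.bracket X Y) p =
        (L.bracket X (S γ₀)).coord p p (μ.coord p p) + Y.dcoord p u (μ.coord p p) := by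
      refine (congrArg (fun φ : DualBundle W p => (φ (μ p) : ℝ)) (hB L X Y)).trans ?_
      rw [h1]
      exact congrArg₂ (· + ·) (dual_apply_eq (mem_baseSet_trivializationAt F W p) _ _)
        (dual_symm_apply (Y.dcoord p u) (μ p))
    refine (congrArg₂ (· - ·) (differential_pairing μ Y p u) h2).trans ?_
    rw [h1]
    change _ = -((L.bracket X (S γ₀)).coord p p (μ.coord p p)) + _
    ring
  refine ⟨((u, γ) : E × (F →L[ℝ] ℝ)), ⟨fun f => ?_, fun μ Y hY => ?_⟩, fun v hv => ?_⟩
  · exact differential_comp_proj f (⟨p, e₀⟩ : TotalSpace (F →L[ℝ] ℝ) (DualBundle W)) (u, γ)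
  · rw [key μ Y hY]
    exact differential_linearFunDual μ (⟨p, e₀⟩ : TotalSpace (F →L[ℝ] ℝ) (DualBundle W)) (u, γ)
  · have hv1 : (v : E × (F →L[ℝ] ℝ)).1 = u := by
      refine (SeparatingDual.eq_iff_forall_dual_eq (R := ℝ)).2 fun h => ?_
      obtain ⟨f, hf⟩ := exists_differential_eq (E := E) p h
      have h1 := (differential_comp_proj f (⟨p, e₀⟩ : TotalSpace (F →L[ℝ] ℝ) (DualBundle W))
        v).symm.trans (hv.basic f)
      change differential 𝓘(ℝ, E) f p _ = differential 𝓘(ℝ, E) f p _ at h1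
      rw [hf] at h1
      exact h1
    have hv2 : (v : E × (F →L[ℝ] ℝ)).2 = γ := by
      ext g
      have h1 := (differential_linearFunDual (T g) (⟨p, e₀⟩ : TotalSpace (F →L[ℝ] ℝ)
        (DualBundle W)) v).symm.trans ((hv.linear (T g) (S γ₀) hS₀).trans (key _ _ hS₀))
      rw [hv1] at h1
      simp only [hTp] at h1
      exact add_right_cancel h1
    exact Prod.ext hv1 hv2

/-- The linear Poisson tensor on `W` of a Lie algebroid `W*`. -/
def linearPoissonTensor (w : TotalSpace F W) : Cotangent (𝓘(ℝ, E).prod 𝓘(ℝ, F)) w →ₗ[ℝ]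
    Cotangent (𝓘(ℝ, E).prod 𝓘(ℝ, F)) w →ₗ[ℝ] ℝ :=
  (existsUnique_isLinearPoissonAt L w).choose

/-- The complete lift of a section of a Lie algebroid `W*`, a vector field on `W*`. -/
def completeLift (X : Sec E (F →L[ℝ] ℝ) (DualBundle W))
    (e : TotalSpace (F →L[ℝ] ℝ) (DualBundle W)) :
    TangentSpace (𝓘(ℝ, E).prod 𝓘(ℝ, F →L[ℝ] ℝ)) e :=
  (existsUnique_isCompleteLiftAt L X e).choose

/-- The Lie derivative of a bivector field `Λ` along a vector field `ζ`, evaluated on the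
differentials of two functions:
`(L_ζ Λ)(df, dg) = ζ(Λ(df, dg)) - Λ(d(ζ f), dg) - Λ(df, d(ζ g))`. -/
def lieDerivBivector {B H N : Type*} [NormedAddCommGroup B] [NormedSpace ℝ B] [TopologicalSpace H]
    (I : ModelWithCorners ℝ B H) [TopologicalSpace N] [ChartedSpace H N]
    (ζ : ∀ x : N, TangentSpace I x) (Λ : ∀ x : N, Cotangent I x →ₗ[ℝ] Cotangent I x →ₗ[ℝ] ℝ)
    (f g : N → ℝ) (x : N) : ℝ :=
  differential I (fun y => Λ y (differential I f y) (differential I g y)) x (ζ x) -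
    Λ x (differential I (fun y => differential I f y (ζ y)) x) (differential I g x) -
    Λ x (differential I f x) (differential I (fun y => differential I g y (ζ y)) x)

end PoissonAndCompleteLift

end
/-!
Sections `X` of `A` satisfy `⟨φ, X⟩ = 1`, so on them the anchor terms in `dφ` and `L_X φ` vanish and
`dφ(X, Y) = -⟨φ, [X, Y]⟩ = ⟨L_X φ, Y⟩`. Every section of `Â` is `(⟨φ, X⟩ - 1) α + β` with sections
`α`, `β` of `A`, and `dφ` is `C^∞(M)`-bilinear, so `dφ = 0` as soon as the brackets of sections of
`A` lie in `V(A) = {ι_φ = 0}`. The affgebroid axioms are then the Jacobi identity and the Leibniz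
rule of `Â`.

As `A = {ι_φ = 1}`, the complete lift of `X` is tangent to `A` iff it annihilates `ι_φ` along `A`,
that is, iff `L_X φ` vanishes on `A`; this can be tested on sections, because every point of `A`
lies on a global section.

The vertical lift of `φ` kills functions pulled back from `M` and sends `ι_X` to `⟨φ, X⟩ ∘ π`, so
the Lie derivative of `Λ` along it takes the value `-dφ(X, Y) ∘ π` on the differentials of
`ι_X + f ∘ π` and `ι_Y + g ∘ π`. Functions of this form serve as coordinates near every point of
`A†`, and a Lie derivative of a bivector field vanishes if it does so on coordinates.
-/

noncomputable section

section HullModel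

variable (F : Type*) [NormedAddCommGroup F] [NormedSpace ℝ F]

/-- The embedding `V(A) ↪ Â` on the model fibres: a vector `x` is sent to `(ℓ, b) ↦ ℓ x`. -/
def hullModelVector : F →L[ℝ] VectorHullModel F :=
  (ContinuousLinearMap.compL ℝ (AffineDualModel F) (F →L[ℝ] ℝ) ℝ).flip
    (ContinuousLinearMap.fst ℝ _ ℝ) ∘L ContinuousLinearMap.apply ℝ ℝ

variable {F} in
@[simp] lemma hullModelVector_apply (x : F) (m : AffineDualModel F) :
    hullModelVector F x m = m.1 x := rfl

variable [FiniteDimensional ℝ F]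

/-- The left inverse of `hullModelVector` given by restricting a functional on the affine functions
`(ℓ, b)` to the linear functions `(ℓ, 0)` and identifying `F` with its bidual. -/
def hullModelPoint : VectorHullModel F →L[ℝ] F :=
  (ContinuousLinearMap.apply ℝ ℝ : F →L[ℝ] (F →L[ℝ] ℝ) →L[ℝ] ℝ).inverse ∘L
    (ContinuousLinearMap.compL ℝ (F →L[ℝ] ℝ) (AffineDualModel F) ℝ).flip
      (ContinuousLinearMap.inl ℝ _ ℝ)

lemma isInvertible_continuousLinearMap_apply :
    (ContinuousLinearMap.apply ℝ ℝ : F →L[ℝ] (F →L[ℝ] ℝ) →L[ℝ] ℝ).IsInvertible := by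
  let : AddCommGroup ((F →L[ℝ] ℝ) →L[ℝ] ℝ) := ContinuousLinearMap.addCommGroup
  let c : ((F →L[ℝ] ℝ) →L[ℝ] ℝ) ≃ₗ[ℝ] Module.Dual ℝ (Module.Dual ℝ F) :=
    LinearMap.toContinuousLinearMap.symm ≪≫ₗ LinearMap.toContinuousLinearMap.symm.dualMap.symm
  exact ⟨((Module.evalEquiv ℝ F) ≪≫ₗ c.symm).toContinuousLinearEquiv, by ext; rfl⟩

variable {F}

lemma apply_hullModelPoint (γ : VectorHullModel F) (ℓ : F →L[ℝ] ℝ) :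
    ℓ (hullModelPoint F γ) = γ (ℓ, 0) :=
  DFunLike.congr_fun ((isInvertible_continuousLinearMap_apply F).self_apply_inverse
    (γ ∘L ContinuousLinearMap.inl ℝ (F →L[ℝ] ℝ) ℝ)) ℓ

lemma hullModelPoint_eq {γ : VectorHullModel F} {x : F} (h : ∀ ℓ : F →L[ℝ] ℝ, γ (ℓ, 0) = ℓ x) :
    hullModelPoint F γ = x :=
  (SeparatingDual.eq_iff_forall_dual_eq (R := ℝ)).2 fun ℓ => by rw [apply_hullModelPoint, h]

lemma hullModelPoint_hullModelVector (x : F) : hullModelPoint F (hullModelVector F x) = x :=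
  hullModelPoint_eq fun _ => rfl

lemma hullModelVector_hullModelPoint_add (γ : VectorHullModel F) :
    hullModelVector F (hullModelPoint F γ) + γ (0, 1) • ContinuousLinearMap.snd ℝ _ ℝ = γ := by
  refine ContinuousLinearMap.ext fun m => ?_
  have hm : m = (m.1, 0) + m.2 • ((0, 1) : AffineDualModel F) := by ext <;> simp
  conv_rhs => rw [hm, map_add, map_smul]
  simp [apply_hullModelPoint, mul_comm]

end HullModel

lemma isInvertible_linearPart {M F : Type*} [TopologicalSpace M] [NormedAddCommGroup F]
    [NormedSpace ℝ F] [FiniteDimensional ℝ F] {V A : M → Type*} [∀ p, AddCommGroup (V p)]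
    [∀ p, Module ℝ (V p)] [∀ p, TopologicalSpace (V p)] [TopologicalSpace (TotalSpace F V)]
    [FiberBundle F V] [∀ p, AddTorsor (V p) (A p)] [TopologicalSpace (TotalSpace F A)]
    {e : Trivialization F (π F A)}
    {e' : Trivialization F (π F V)} [e'.IsLinear ℝ] {q : M} (hq : q ∈ e.baseSet)
    (hq' : q ∈ e'.baseSet) {T : F →L[ℝ] F}
    (hT : ∀ (v : V q) (a : A q), (e ⟨q, v +ᵥ a⟩).2 = T (e' ⟨q, v⟩).2 + (e ⟨q, a⟩).2) :
    T.IsInvertible := by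
  obtain ⟨a⟩ : Nonempty (A q) := inferInstance
  have hinj : Function.Injective T := by
    refine (injective_iff_map_eq_zero T).2 fun x hx => ?_
    obtain ⟨v, rfl⟩ := (fiberEquiv e' q hq').surjective x
    have h := hT v a
    rw [fiberEquiv_apply] at hx
    rw [hx, zero_add] at h
    have hv : v +ᵥ a = (0 : V q) +ᵥ a := by
      rw [zero_vadd]
      exact (fiberEquiv e q hq).injective h
    rw [vadd_right_cancel a hv, fiberEquiv_apply]
    exact (e'.linear ℝ hq').map_zero
  exact ⟨(LinearEquiv.ofInjectiveEndo (T : F →ₗ[ℝ] F) hinj).toContinuousLinearEquiv, by ext; rfl⟩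

section HullFibres

variable {E : Type*} [NormedAddCommGroup E] [NormedSpace ℝ E]
  {M : Type*} [TopologicalSpace M] [ChartedSpace E M]
  {F : Type*} [NormedAddCommGroup F] [NormedSpace ℝ F] [FiniteDimensional ℝ F]
  {V : M → Type*} [∀ p, AddCommGroup (V p)] [∀ p, Module ℝ (V p)]
  [∀ p, TopologicalSpace (V p)] [TopologicalSpace (TotalSpace F V)]
  [FiberBundle F V] [VectorBundle ℝ F V]
  {A : M → Type*} [∀ p, AddTorsor (V p) (A p)]
  [∀ p, TopologicalSpace (A p)] [TopologicalSpace (TotalSpace F A)] [FiberBundle F A]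
  [SmoothAffineBundle E F V A]

@[simp] lemma hullPoint_apply {p : M} (a : A p) (f : AffineDual E F V A p) :
    (hullPoint E F V a f : ℝ) = f a := rfl

@[simp] lemma hullPoint_apply_one {p : M} (a : A p) :
    (hullPoint E F V a (AffineDual.one E F V A p) : ℝ) = 1 := rfl

@[simp] lemma hullVector_apply_one {p : M} (v : V p) :
    (hullVector E F A v (AffineDual.one E F V A p) : ℝ) = 0 := rfl

lemma hullVector_add {p : M} (v w : V p) :
    hullVector E F A (v + w) = hullVector E F A v + hullVector E F A w :=
  ContinuousLinearMap.ext fun f =>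
    map_add (AffineMap.linear (k := ℝ) (V1 := V p) (V2 := ℝ) (P1 := A p) f) v w

lemma hullVector_smul {p : M} (r : ℝ) (v : V p) :
    hullVector E F A (r • v) = r • hullVector E F A v :=
  ContinuousLinearMap.ext fun f =>
    map_smul (AffineMap.linear (k := ℝ) (V1 := V p) (V2 := ℝ) (P1 := A p) f) r v

lemma hullPoint_vadd {p : M} (v : V p) (a : A p) :
    hullPoint E F V (v +ᵥ a) = hullVector E F A v + hullPoint E F V a :=
  ContinuousLinearMap.ext fun f => AffineDual.map_vadd f v a

lemma hullVector_eq_sub {p : M} (v : V p) (a : A p) :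
    hullVector E F A v = hullPoint E F V (v +ᵥ a) - hullPoint E F V a :=
  eq_sub_of_add_eq (hullPoint_vadd v a).symm

lemma hullPoint_injective (p : M) :
    Function.Injective (hullPoint E F V : A p → VectorHull E F V A p) := by
  intro a b h
  have hp := mem_baseSet_trivializationAt F A p
  refine (fiberEquiv (trivializationAt F A p) p hp).injective ?_
  refine (SeparatingDual.eq_iff_forall_dual_eq (R := ℝ)).2 fun ℓ => ?_
  simpa [AffineDual.coordEquiv_symm_apply] using DFunLike.congr_fun h
    ((AffineDual.coordEquiv E V (trivializationAt F A p) p hp).symm (ℓ, 0))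

lemma hullVector_injective (p : M) :
    Function.Injective (hullVector E F A : V p → VectorHull E F V A p) := by
  intro v w h
  obtain ⟨a⟩ : Nonempty (A p) := inferInstance
  rw [hullVector_eq_sub v a, hullVector_eq_sub w a, sub_left_inj] at h
  exact vadd_right_cancel a (hullPoint_injective p h)

lemma oneSection_coord {p q : M} (hq : q ∈ (trivializationAt F A p).baseSet) :
    (oneSection E F V A).coord p q = (0, 1) := by
  change (trivializationAt (AffineDualModel F) (AffineDual E F V A) p
    ⟨q, AffineDual.one E F V A q⟩).2 = _
  rw [AffineDual.trivializationAt_apply E F V A hq]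
  exact (AffineDual.coordEquiv_eq_iff E F V A _ q hq _ _).2 fun _ => (zero_add 1).symm

lemma pairing_oneSection_hullSection (α : Sec E F A) :
    pairing (oneSection E F V A) (hullSection α) = fun _ => 1 := rfl

end HullFibres

section HullCoordinates

variable {E : Type*} [NormedAddCommGroup E] [NormedSpace ℝ E]
  {M : Type*} [TopologicalSpace M] [ChartedSpace E M] [T2Space M]
  {F : Type*} [NormedAddCommGroup F] [NormedSpace ℝ F] [FiniteDimensional ℝ F]
  {V : M → Type*} [∀ p, AddCommGroup (V p)] [∀ p, Module ℝ (V p)]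
  [∀ p, TopologicalSpace (V p)] [TopologicalSpace (TotalSpace F V)]
  [FiberBundle F V] [VectorBundle ℝ F V]
  {A : M → Type*} [∀ p, AddTorsor (V p) (A p)]
  [∀ p, TopologicalSpace (A p)] [TopologicalSpace (TotalSpace F A)] [FiberBundle F A]
  [SmoothAffineBundle E F V A]

lemma vectorHull_coord_apply {p q : M} (hq : q ∈ (trivializationAt F A p).baseSet)
    (Z : VectorHull E F V A q) (m : AffineDualModel F) :
    (trivializationAt (VectorHullModel F) (VectorHull E F V A) p ⟨q, Z⟩).2 m =
      Z ((AffineDual.coordEquiv E V (trivializationAt F A p) q hq).symm m) := by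
  rw [dual_apply_eq (F := AffineDualModel F) (W := AffineDual E F V A) (p := p) hq,
    AffineDual.trivializationAt_apply E F V A hq, LinearEquiv.apply_symm_apply]

lemma vectorHull_coord_one {p q : M} (hq : q ∈ (trivializationAt F A p).baseSet)
    (Z : VectorHull E F V A q) :
    (trivializationAt (VectorHullModel F) (VectorHull E F V A) p ⟨q, Z⟩).2 (0, 1) =
      Z (AffineDual.one E F V A q) := by
  rw [dual_apply_eq (F := AffineDualModel F) (W := AffineDual E F V A) (p := p) hq]
  exact congrArg _ (oneSection_coord (E := E) (V := V) hq).symm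

lemma hullPoint_coord {p q : M} (hq : q ∈ (trivializationAt F A p).baseSet) (a : A q) :
    (trivializationAt (VectorHullModel F) (VectorHull E F V A) p ⟨q, hullPoint E F V a⟩).2 =
      hullModelVector F (trivializationAt F A p ⟨q, a⟩).2 + ContinuousLinearMap.snd ℝ _ ℝ :=
  ContinuousLinearMap.ext fun m => vectorHull_coord_apply hq _ m

lemma hullModelPoint_coord_hullPoint {p q : M} (hq : q ∈ (trivializationAt F A p).baseSet)
    (a : A q) : hullModelPoint F
      (trivializationAt (VectorHullModel F) (VectorHull E F V A) p ⟨q, hullPoint E F V a⟩).2 =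
        (trivializationAt F A p ⟨q, a⟩).2 :=
  hullModelPoint_eq fun ℓ => by simp [hullPoint_coord hq]

lemma exists_hullPoint_eq {p : M} {Z : VectorHull E F V A p}
    (hZ : (Z (AffineDual.one E F V A p) : ℝ) = 1) : ∃ a : A p, hullPoint E F V a = Z := by
  have hp := mem_baseSet_trivializationAt F A p
  set γ := (trivializationAt (VectorHullModel F) (VectorHull E F V A) p ⟨p, Z⟩).2 with hγ
  have hγ_one : γ (0, 1) = 1 := by rw [hγ, vectorHull_coord_one hp, hZ]
  obtain ⟨a, ha⟩ := (fiberEquiv (trivializationAt F A p) p hp).surjective (hullModelPoint F γ)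
  refine ⟨a, coord_injective (F := VectorHullModel F) (V := VectorHull E F V A) ?_⟩
  rw [fiberEquiv_apply] at ha
  have h := hullModelVector_hullModelPoint_add γ
  rw [hγ_one, one_smul] at h
  rw [hullPoint_coord hp, ha, h]

lemma exists_hullVector_eq {p : M} {Z : VectorHull E F V A p}
    (hZ : (Z (AffineDual.one E F V A p) : ℝ) = 0) : ∃ v : V p, hullVector E F A v = Z := by
  obtain ⟨a⟩ : Nonempty (A p) := inferInstance
  obtain ⟨b, hb⟩ := exists_hullPoint_eq (Z := hullPoint E F V a + Z) (by
    change hullPoint E F V a (AffineDual.one E F V A p) + (Z (AffineDual.one E F V A p) : ℝ) = 1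
    rw [hullPoint_apply_one, hZ, add_zero])
  exact ⟨b -ᵥ a, by rw [hullVector_eq_sub _ a, vsub_vadd, hb, add_sub_cancel_left]⟩

lemma hullVector_coord {p q : M} (hq : q ∈ (trivializationAt F A p).baseSet) {T : F →L[ℝ] F}
    (hT : ∀ (v : V q) (a : A q), (trivializationAt F A p ⟨q, v +ᵥ a⟩).2 =
      T (trivializationAt F V p ⟨q, v⟩).2 + (trivializationAt F A p ⟨q, a⟩).2) (v : V q) :
    (trivializationAt (VectorHullModel F) (VectorHull E F V A) p ⟨q, hullVector E F A v⟩).2 =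
      hullModelVector F (T (trivializationAt F V p ⟨q, v⟩).2) := by
  obtain ⟨a⟩ : Nonempty (A q) := inferInstance
  refine ContinuousLinearMap.ext fun m => ?_
  rw [vectorHull_coord_apply hq, hullVector_eq_sub v a, sub_apply, hullPoint_apply, hullPoint_apply,
    AffineDual.coordEquiv_symm_apply, AffineDual.coordEquiv_symm_apply, hT]
  simp

end HullCoordinates

section HullSections

variable {E : Type*} [NormedAddCommGroup E] [NormedSpace ℝ E]
  {M : Type*} [TopologicalSpace M] [ChartedSpace E M] [T2Space M]
  {F : Type*} [NormedAddCommGroup F] [NormedSpace ℝ F] [FiniteDimensional ℝ F]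
  {V : M → Type*} [∀ p, AddCommGroup (V p)] [∀ p, Module ℝ (V p)]
  [∀ p, TopologicalSpace (V p)] [TopologicalSpace (TotalSpace F V)]
  [FiberBundle F V] [VectorBundle ℝ F V]
  {A : M → Type*} [∀ p, AddTorsor (V p) (A p)]
  [∀ p, TopologicalSpace (A p)] [TopologicalSpace (TotalSpace F A)] [FiberBundle F A]
  [SmoothAffineBundle E F V A]

variable (E F V A) in
lemma exists_hullVector_coord_eq (p : M) : ∃ T : M → F →L[ℝ] F,
    ContMDiffAt 𝓘(ℝ, E) 𝓘(ℝ, F →L[ℝ] F) ∞ T p ∧ ∀ᶠ q in 𝓝 p,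
      q ∈ (trivializationAt F A p).baseSet ∧ (T q).IsInvertible ∧ ∀ v : V q,
        (trivializationAt (VectorHullModel F) (VectorHull E F V A) p ⟨q, hullVector E F A v⟩).2 =
          hullModelVector F (T q (trivializationAt F V p ⟨q, v⟩).2) := by
  obtain ⟨T, hT, h⟩ := SmoothAffineBundle.exists_linearPart (E := E)
    (trivializationAt F A p) (trivializationAt F V p)
  have hs : (trivializationAt F A p).baseSet ∩ (trivializationAt F V p).baseSet ∈ 𝓝 p :=
    Filter.inter_mem
      ((trivializationAt F A p).open_baseSet.mem_nhds (mem_baseSet_trivializationAt F A p))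
      ((trivializationAt F V p).open_baseSet.mem_nhds (mem_baseSet_trivializationAt F V p))
  refine ⟨T, hT.contMDiffAt hs, ?_⟩
  filter_upwards [hs] with q hq
  exact ⟨hq.1, isInvertible_linearPart hq.1 hq.2 (h q hq), hullVector_coord hq.1 (h q hq)⟩

lemma contMDiff_hullVector (X : Sec E F V) :
    ContMDiff 𝓘(ℝ, E) (𝓘(ℝ, E).prod 𝓘(ℝ, VectorHullModel F)) ∞ fun p =>
      (⟨p, hullVector E F A (X p)⟩ : TotalSpace (VectorHullModel F) (VectorHull E F V A)) := by
  intro p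
  rw [contMDiffAt_section]
  obtain ⟨T, hT, h⟩ := exists_hullVector_coord_eq E F V A p
  have hX := (contMDiffAt_section (n := ∞) p).1 (X.contMDiff p)
  have hJ : ContMDiff 𝓘(ℝ, F) 𝓘(ℝ, VectorHullModel F) ∞ (hullModelVector F) :=
    ContinuousLinearMap.contMDiff _
  refine (hJ.contMDiffAt.comp p (hT.clm_apply hX)).congr_of_eventuallyEq ?_
  filter_upwards [h] with q hq using hq.2.2 (X q)

variable (A) in
/-- The inclusion `Sec(V(A)) ⊂ Sec(Â)`. -/
def hullVectorSection : Sec E F V →ₗ[ℝ] Sec E (VectorHullModel F) (VectorHull E F V A) where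
  toFun X := ⟨fun p => hullVector E F A (X p), contMDiff_hullVector X⟩
  map_add' X Y := ContMDiffSection.ext fun p => hullVector_add (X p) (Y p)
  map_smul' r X := ContMDiffSection.ext fun p => hullVector_smul r (X p)

@[simp] lemma hullVectorSection_apply (X : Sec E F V) (p : M) :
    hullVectorSection A X p = hullVector E F A (X p) := rfl

lemma hullVectorSection_injective :
    Function.Injective (hullVectorSection A :
      Sec E F V → Sec E (VectorHullModel F) (VectorHull E F V A)) := fun _ _ h =>
  ContMDiffSection.ext fun p => hullVector_injective p (DFunLike.congr_fun h p)

lemma hullSection_vadd (X : Sec E F V) (α : Sec E F A) :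
    hullSection (X +ᵥ α) = hullVectorSection A X + hullSection α :=
  ContMDiffSection.ext fun p => hullPoint_vadd (X p) (α p)

lemma hullVectorSection_fsmul (f : C^∞⟮𝓘(ℝ, E), M; ℝ⟯) (X : Sec E F V) :
    hullVectorSection A (X.fsmul f) = (hullVectorSection A X).fsmul f :=
  ContMDiffSection.ext fun p => hullVector_smul (f p) (X p)

lemma exists_hullSection_eq {Z : Sec E (VectorHullModel F) (VectorHull E F V A)}
    (hZ : ∀ p, pairing (oneSection E F V A) Z p = 1) : ∃ β : Sec E F A, hullSection β = Z := by
  choose b hb using fun p => exists_hullPoint_eq (hZ p)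
  refine ⟨⟨b, fun p => ?_⟩, ContMDiffSection.ext hb⟩
  rw [contMDiffAt_section]
  have hZp := (contMDiffAt_section (n := ∞) p).1 (Z.contMDiff p)
  have hR : ContMDiff 𝓘(ℝ, VectorHullModel F) 𝓘(ℝ, F) ∞ (hullModelPoint F) :=
    ContinuousLinearMap.contMDiff _
  refine (hR.contMDiffAt.comp p hZp).congr_of_eventuallyEq ?_
  filter_upwards [(trivializationAt F A p).open_baseSet.mem_nhds
    (mem_baseSet_trivializationAt F A p)] with q hq
  rw [Function.comp_apply, ← hb q, hullModelPoint_coord_hullPoint hq]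

lemma exists_hullVectorSection_eq {Z : Sec E (VectorHullModel F) (VectorHull E F V A)}
    (hZ : ∀ p, pairing (oneSection E F V A) Z p = 0) :
    ∃ X : Sec E F V, hullVectorSection A X = Z := by
  choose v hv using fun p => exists_hullVector_eq (hZ p)
  refine ⟨⟨v, fun p => ?_⟩, ContMDiffSection.ext hv⟩
  rw [contMDiffAt_section]
  obtain ⟨T, hT, h⟩ := exists_hullVector_coord_eq E F V A p
  have hT_inv : ContMDiffAt 𝓘(ℝ, E) 𝓘(ℝ, F →L[ℝ] F) ∞ (fun q => (T q).inverse) p :=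
    h.self_of_nhds.2.1.contDiffAt_map_inverse.contMDiffAt.comp p hT
  have hZp := (contMDiffAt_section (n := ∞) p).1 (Z.contMDiff p)
  have hR : ContMDiff 𝓘(ℝ, VectorHullModel F) 𝓘(ℝ, F) ∞ (hullModelPoint F) :=
    ContinuousLinearMap.contMDiff _
  refine (hT_inv.clm_apply (hR.contMDiffAt.comp p hZp)).congr_of_eventuallyEq ?_
  filter_upwards [h] with q hq
  rw [Function.comp_apply, ← hv q, hq.2.2, hullModelPoint_hullModelVector]
  exact ((hq.2.1.inverse_apply_eq).2 rfl).symm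

lemma exists_hullVector_eq_iff {Z : Sec E (VectorHullModel F) (VectorHull E F V A)} :
    (∃ X : Sec E F V, ∀ p, hullVector E F A (X p) = Z p) ↔
      ∀ p, pairing (oneSection E F V A) Z p = 0 := by
  refine ⟨fun ⟨X, hX⟩ p => ?_, fun hZ => ?_⟩
  · rw [pairing, ← hX p]
    exact hullVector_apply_one (X p)
  · obtain ⟨X, rfl⟩ := exists_hullVectorSection_eq hZ
    exact ⟨X, fun _ => rfl⟩

end HullSections

section SectionsOfVectorBundles

variable {E : Type*} [NormedAddCommGroup E] [NormedSpace ℝ E] [FiniteDimensional ℝ E]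
  {M : Type*} [TopologicalSpace M] [ChartedSpace E M] [IsManifold 𝓘(ℝ, E) ∞ M] [T2Space M]
  {F : Type*} [NormedAddCommGroup F] [NormedSpace ℝ F] [FiniteDimensional ℝ F]
  {V : M → Type*} [∀ p, AddCommGroup (V p)] [∀ p, Module ℝ (V p)]
  [∀ p, TopologicalSpace (V p)] [TopologicalSpace (TotalSpace F V)]
  [FiberBundle F V] [VectorBundle ℝ F V] [ContMDiffVectorBundle ∞ F V 𝓘(ℝ, E)]

lemma exists_coord_eventuallyEq (p : M) (x : F) :
    ∃ X : Sec E F V, ∀ᶠ q in 𝓝 p, X.coord p q = x := by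
  obtain ⟨S, hS, -⟩ := exists_frame (E := E) (F := F) (V := V) p
  exact ⟨S x, hS x⟩

lemma exists_sec_eq {p : M} (v : V p) : ∃ X : Sec E F V, X p = v := by
  obtain ⟨X, hX⟩ := exists_coord_eventuallyEq (E := E) (V := V) p (trivializationAt F V p ⟨p, v⟩).2
  exact ⟨X, coord_injective hX.self_of_nhds⟩

end SectionsOfVectorBundles

section SectionsOfAffineBundles

variable {E : Type*} [NormedAddCommGroup E] [NormedSpace ℝ E] [FiniteDimensional ℝ E]
  {M : Type*} [TopologicalSpace M] [ChartedSpace E M] [IsManifold 𝓘(ℝ, E) ∞ M] [T2Space M]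
  [SigmaCompactSpace M]
  {F : Type*} [NormedAddCommGroup F] [NormedSpace ℝ F] [FiniteDimensional ℝ F]
  {V : M → Type*} [∀ p, AddCommGroup (V p)] [∀ p, Module ℝ (V p)]
  [∀ p, TopologicalSpace (V p)] [TopologicalSpace (TotalSpace F V)]
  [FiberBundle F V] [VectorBundle ℝ F V]
  {A : M → Type*} [∀ p, AddTorsor (V p) (A p)]
  [∀ p, TopologicalSpace (A p)] [TopologicalSpace (TotalSpace F A)] [FiberBundle F A]
  [SmoothAffineBundle E F V A]

variable (E F V A) in
include V in
lemma nonempty_affineSection : Nonempty (Sec E F A) := by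
  have hconvex : ∀ p, Convex ℝ
      {Z : VectorHull E F V A p | (Z (AffineDual.one E F V A p) : ℝ) = 1} := by
    intro p Z hZ Z' hZ' a b _ _ hab
    change a * (Z (AffineDual.one E F V A p) : ℝ) + b * (Z' (AffineDual.one E F V A p) : ℝ) = 1
    rw [hZ, hZ', mul_one, mul_one, hab]
  obtain ⟨Z, hZ⟩ := exists_contMDiffSection_forall_mem_convex_of_local 𝓘(ℝ, E) (n := ⊤)
    (F_fiber := VectorHullModel F) (VectorHull E F V A) _ hconvex fun p => by
      obtain ⟨Z, hZ⟩ := exists_coord_eventuallyEq (E := E) (F := VectorHullModel F)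
        (V := VectorHull E F V A) p (ContinuousLinearMap.snd ℝ _ _)
      refine ⟨_, Filter.inter_mem hZ ((trivializationAt F A p).open_baseSet.mem_nhds
        (mem_baseSet_trivializationAt F A p)), Z, Z.contMDiff.contMDiffOn, fun q hq => ?_⟩
      have hZq : Z.coord p q = ContinuousLinearMap.snd ℝ _ _ := hq.1
      change (Z q (AffineDual.one E F V A q) : ℝ) = 1
      rw [← vectorHull_coord_one hq.2]
      exact DFunLike.congr_fun hZq (0, 1)
  exact ⟨(exists_hullSection_eq hZ).choose⟩

variable [ContMDiffVectorBundle ∞ F V 𝓘(ℝ, E)]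

include V in
lemma exists_affineSection_eq {p : M} (a : A p) : ∃ β : Sec E F A, β p = a := by
  obtain ⟨α⟩ := nonempty_affineSection E F V A
  obtain ⟨X, hX⟩ := exists_sec_eq (E := E) (F := F) (a -ᵥ α p : V p)
  exact ⟨X +ᵥ α, by rw [Sec.vadd_apply, hX, vsub_vadd]⟩

end SectionsOfAffineBundles

section InducedLieAffgebroid

variable {E : Type*} [NormedAddCommGroup E] [NormedSpace ℝ E]
  {M : Type*} [TopologicalSpace M] [ChartedSpace E M] [IsManifold 𝓘(ℝ, E) 1 M]
  {F : Type*} [NormedAddCommGroup F] [NormedSpace ℝ F]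
  {V : M → Type*} [∀ p, AddCommGroup (V p)] [∀ p, Module ℝ (V p)]
  [∀ p, TopologicalSpace (V p)] [TopologicalSpace (TotalSpace F V)]
  [FiberBundle F V] [VectorBundle ℝ F V]

lemma LieAlgebroid.bracket_self (L : LieAlgebroid E F V) (X : Sec E F V) : L.bracket X X = 0 :=
  have := IsAddTorsionFree.of_isTorsionFree ℝ (Sec E F V)
  self_eq_neg.1 (L.bracket_skew X X)

lemma LieAlgebroid.bracket_add_self (L : LieAlgebroid E F V) (X Y : Sec E F V) :
    L.bracket X (Y + X) = L.bracket X Y := by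
  rw [map_add, L.bracket_self, add_zero]

variable [T2Space M] [FiniteDimensional ℝ F]
  {A : M → Type*} [∀ p, AddTorsor (V p) (A p)]
  [∀ p, TopologicalSpace (A p)] [TopologicalSpace (TotalSpace F A)] [FiberBundle F A]
  [SmoothAffineBundle E F V A]

omit [IsManifold 𝓘(ℝ, E) 1 M] in
variable (E F V A) in
lemma contMDiff_hullMap : ContMDiff (𝓘(ℝ, E).prod 𝓘(ℝ, F)) (𝓘(ℝ, E).prod 𝓘(ℝ, VectorHullModel F))
    ∞ (hullMap E F V A) := by
  intro a
  have hid : ContMDiffAt (𝓘(ℝ, E).prod 𝓘(ℝ, F)) (𝓘(ℝ, E).prod 𝓘(ℝ, F)) ∞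
    (id : TotalSpace F A → TotalSpace F A) a := contMDiffAt_id
  rw [contMDiffAt_totalSpace] at hid ⊢
  have hJ : ContMDiff 𝓘(ℝ, F) 𝓘(ℝ, VectorHullModel F) ∞ (hullModelVector F) :=
    ContinuousLinearMap.contMDiff _
  have h : ContMDiffAt (𝓘(ℝ, E).prod 𝓘(ℝ, F)) 𝓘(ℝ, VectorHullModel F) ∞
      (fun b : TotalSpace F A => hullModelVector F (trivializationAt F A a.1 b).2 +
        ContinuousLinearMap.snd ℝ (F →L[ℝ] ℝ) ℝ) a :=
    (hJ.contMDiffAt.comp a hid.2).add contMDiffAt_const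
  refine ⟨hid.1, h.congr_of_eventuallyEq ?_⟩
  have hbase : π F A ⁻¹' (trivializationAt F A a.1).baseSet ∈ 𝓝 a :=
    (FiberBundle.continuous_proj F A).continuousAt.preimage_mem_nhds
      ((trivializationAt F A a.1).open_baseSet.mem_nhds (mem_baseSet_trivializationAt F A a.1))
  filter_upwards [hbase] with b hb using hullPoint_coord hb b.2

variable {L : LieAlgebroid E (VectorHullModel F) (VectorHull E F V A)}

variable (L) in
/-- The anchor of `Â` restricted to a fibre of `A`. -/
def inducedAnchor (p : M) : A p →ᵃ[ℝ] TangentSpace 𝓘(ℝ, E) p where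
  toFun a := L.anchor p (hullPoint E F V a)
  linear :=
    { toFun := fun v => L.anchor p (hullVector E F A v)
      map_add' := fun v w => by rw [hullVector_add, map_add]
      map_smul' := fun r v => by rw [hullVector_smul, map_smul, RingHom.id_apply] }
  map_vadd' a v := (congrArg (L.anchor p) (hullPoint_vadd v a)).trans (map_add (L.anchor p) _ _)

variable (h : ∀ α β : Sec E F A, ∃ X : Sec E F V,
  hullVectorSection A X = L.bracket (hullSection α) (hullSection β))

/-- The bracket of sections of `A` as a section of `V(A)`. -/
def inducedBracket (α β : Sec E F A) : Sec E F V := (h α β).choose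

lemma hullVectorSection_inducedBracket (α β : Sec E F A) :
    hullVectorSection A (inducedBracket h α β) = L.bracket (hullSection α) (hullSection β) :=
  (h α β).choose_spec

include h in
lemma bracket_hullVectorSection_mem_range (α : Sec E F A) (X : Sec E F V) :
    L.bracket (hullSection α) (hullVectorSection A X) ∈ (hullVectorSection A).range := by
  obtain ⟨Y, hY⟩ := h α (X +ᵥ α)
  exact ⟨Y, by rw [hY, hullSection_vadd, L.bracket_add_self]⟩

/-- The linear part of `inducedBracket h α`: the operator `[α, ·]` of `Â` on `Sec(V(A))`. -/
def inducedLinPart (α : Sec E F A) : Sec E F V →ₗ[ℝ] Sec E F V :=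
  (LinearEquiv.ofInjective (hullVectorSection A) hullVectorSection_injective).symm.toLinearMap ∘ₗ
    (L.bracket (hullSection α) ∘ₗ hullVectorSection A).codRestrict _
      (bracket_hullVectorSection_mem_range h α)

lemma hullVectorSection_inducedLinPart (α : Sec E F A) (X : Sec E F V) :
    hullVectorSection A (inducedLinPart h α X) =
      L.bracket (hullSection α) (hullVectorSection A X) :=
  congrArg Subtype.val
    ((LinearEquiv.ofInjective (hullVectorSection A) hullVectorSection_injective).apply_symm_apply
      ⟨_, bracket_hullVectorSection_mem_range h α X⟩)

lemma inducedLinPart_fsmul (α : Sec E F A) (f : C^∞⟮𝓘(ℝ, E), M; ℝ⟯) (X : Sec E F V) (p : M) :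
    inducedLinPart h α (X.fsmul f) p = f p • inducedLinPart h α X p +
      differential 𝓘(ℝ, E) f p (inducedAnchor L p (α p)) • X p := by
  refine hullVector_injective (E := E) (F := F) (A := A) p ?_
  rw [hullVector_add, hullVector_smul, hullVector_smul]
  simp only [← hullVectorSection_apply, hullVectorSection_inducedLinPart, hullVectorSection_fsmul]
  exact L.leibniz (hullSection α) f (hullVectorSection A X) p

/-- The Lie affgebroid structure on `A` induced by a Lie algebroid structure on `Â` for which the
brackets of sections of `A` are sections of `V(A)`. -/
def inducedLieAffgebroid : LieAffgebroid E F V A where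
  bracket := inducedBracket h
  linPart := inducedLinPart h
  bracket_vadd α X β := hullVectorSection_injective (A := A) <| by
    rw [map_add, hullVectorSection_inducedLinPart, hullVectorSection_inducedBracket,
      hullVectorSection_inducedBracket, hullSection_vadd, map_add]
  bracket_skew α β := hullVectorSection_injective (A := A) <| by
    rw [map_neg, hullVectorSection_inducedBracket, hullVectorSection_inducedBracket, L.bracket_skew]
  jacobi α₁ α₂ α₃ := hullVectorSection_injective (A := A) <| by
    simp only [map_add, map_zero, hullVectorSection_inducedLinPart,
      hullVectorSection_inducedBracket, L.jacobi]
  anchor := inducedAnchor L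
  contMDiff_anchor := L.contMDiff_anchor.comp (contMDiff_hullMap E F V A)
  leibniz := inducedLinPart_fsmul h

omit h in
lemma exists_lieAffgebroid_iff :
    (∃ 𝒜 : LieAffgebroid E F V A, ∀ (X Y : Sec E F A) (p : M),
        hullVector E F A (𝒜.bracket X Y p) = L.bracket (hullSection X) (hullSection Y) p) ↔
      ∀ X Y : Sec E F A, ∃ Z : Sec E F V, ∀ p : M,
        hullVector E F A (Z p) = L.bracket (hullSection X) (hullSection Y) p := by
  refine ⟨fun ⟨𝒜, h⟩ X Y => ⟨𝒜.bracket X Y, h X Y⟩, fun h => ?_⟩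
  have hrange : ∀ X Y : Sec E F A, ∃ Z : Sec E F V,
      hullVectorSection A Z = L.bracket (hullSection X) (hullSection Y) := fun X Y =>
    (h X Y).imp fun _ hZ => ContMDiffSection.ext hZ
  exact ⟨inducedLieAffgebroid hrange, fun X Y =>
    DFunLike.congr_fun (hullVectorSection_inducedBracket hrange X Y)⟩

end InducedLieAffgebroid

section Differential

variable {B H N : Type*} [NormedAddCommGroup B] [NormedSpace ℝ B] [TopologicalSpace H]
  {I : ModelWithCorners ℝ B H} [TopologicalSpace N] [ChartedSpace H N] {f g : N → ℝ} {x : N}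

lemma differential_add (hf : MDifferentiableAt I 𝓘(ℝ, ℝ) f x)
    (hg : MDifferentiableAt I 𝓘(ℝ, ℝ) g x) :
    differential I (fun y => f y + g y) x = differential I f x + differential I g x :=
  (hf.hasMFDerivAt.add hg.hasMFDerivAt).mfderiv

lemma differential_mul (hf : MDifferentiableAt I 𝓘(ℝ, ℝ) f x)
    (hg : MDifferentiableAt I 𝓘(ℝ, ℝ) g x) :
    differential I (fun y => f y * g y) x = f x • differential I g x + g x • differential I f x :=
  (hf.hasMFDerivAt.mul hg.hasMFDerivAt).mfderiv

@[simp] lemma differential_const (c : ℝ) : differential I (fun _ : N => c) x = 0 :=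
  mfderiv_const

lemma differential_congr (h : f =ᶠ[𝓝 x] g) : differential I f x = differential I g x :=
  h.mfderiv_eq

end Differential

section ExteriorDerivative

variable {E : Type*} [NormedAddCommGroup E] [NormedSpace ℝ E]
  {M : Type*} [TopologicalSpace M] [ChartedSpace E M] [T2Space M]
  {F : Type*} [NormedAddCommGroup F] [NormedSpace ℝ F] [FiniteDimensional ℝ F]
  {W : M → Type*} [∀ p, AddCommGroup (W p)] [∀ p, Module ℝ (W p)]
  [∀ p, TopologicalSpace (W p)] [TopologicalSpace (TotalSpace F W)]
  [FiberBundle F W] [VectorBundle ℝ F W]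

lemma contMDiff_pairing (μ : Sec E F W) (X : Sec E (F →L[ℝ] ℝ) (DualBundle W)) :
    ContMDiff 𝓘(ℝ, E) 𝓘(ℝ, ℝ) ∞ (pairing μ X) := by
  intro p
  have hμ := (contMDiffAt_section (n := ∞) p).1 (μ.contMDiff p)
  have hX := (contMDiffAt_section (n := ∞) p).1 (X.contMDiff p)
  refine (hX.clm_apply hμ).congr_of_eventuallyEq ?_
  filter_upwards [(trivializationAt F W p).open_baseSet.mem_nhds
    (mem_baseSet_trivializationAt F W p)] with q hq using dual_apply_eq hq _ _

lemma mdifferentiableAt_pairing (μ : Sec E F W) (X : Sec E (F →L[ℝ] ℝ) (DualBundle W)) (p : M) :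
    MDifferentiableAt 𝓘(ℝ, E) 𝓘(ℝ, ℝ) (pairing μ X) p :=
  (contMDiff_pairing μ X).mdifferentiable (by simp) p

/-- The pairing `⟨μ, X⟩` as an element of the ring `C^∞(M)`, by which sections are multiplied. -/
def smoothPairing (μ : Sec E F W) (X : Sec E (F →L[ℝ] ℝ) (DualBundle W)) : C^∞⟮𝓘(ℝ, E), M; ℝ⟯ :=
  ⟨pairing μ X, contMDiff_pairing μ X⟩

variable [IsManifold 𝓘(ℝ, E) 1 M] (L : LieAlgebroid E (F →L[ℝ] ℝ) (DualBundle W))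

omit [T2Space M] [FiniteDimensional ℝ F] in
lemma extDeriv₁_swap (μ : Sec E F W) (X Y : Sec E (F →L[ℝ] ℝ) (DualBundle W)) (p : M) :
    extDeriv₁ L μ X Y p = -extDeriv₁ L μ Y X p := by
  have hbracket : pairing μ (L.bracket X Y) p = -pairing μ (L.bracket Y X) p :=
    congrArg (pairing μ · p) (L.bracket_skew X Y)
  rw [extDeriv₁, extDeriv₁, hbracket]
  ring

lemma extDeriv₁_add_right (μ : Sec E F W) (X Y Z : Sec E (F →L[ℝ] ℝ) (DualBundle W)) (p : M) :
    extDeriv₁ L μ X (Y + Z) p = extDeriv₁ L μ X Y p + extDeriv₁ L μ X Z p := by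
  have hpairing : differential 𝓘(ℝ, E) (pairing μ (Y + Z)) p =
      differential 𝓘(ℝ, E) (pairing μ Y) p + differential 𝓘(ℝ, E) (pairing μ Z) p :=
    differential_add (mdifferentiableAt_pairing μ Y p) (mdifferentiableAt_pairing μ Z p)
  have hbracket : pairing μ (L.bracket X (Y + Z)) p =
      pairing μ (L.bracket X Y) p + pairing μ (L.bracket X Z) p :=
    congrArg (pairing μ · p) (map_add (L.bracket X) Y Z)
  have hanchor : L.anchor p ((Y + Z) p) = L.anchor p (Y p) + L.anchor p (Z p) :=
    map_add (L.anchor p) (Y p) (Z p)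
  rw [extDeriv₁, extDeriv₁, extDeriv₁, hpairing, hbracket, hanchor, map_add, _root_.add_apply]
  ring

lemma extDeriv₁_fsmul_right (μ : Sec E F W) (X Y : Sec E (F →L[ℝ] ℝ) (DualBundle W))
    (f : C^∞⟮𝓘(ℝ, E), M; ℝ⟯) (p : M) :
    extDeriv₁ L μ X (Y.fsmul f) p = f p * extDeriv₁ L μ X Y p := by
  have hpairing (v : TangentSpace 𝓘(ℝ, E) p) :
      differential 𝓘(ℝ, E) (pairing μ (Y.fsmul f)) p v =
        f p * differential 𝓘(ℝ, E) (pairing μ Y) p v + pairing μ Y p * differential 𝓘(ℝ, E) f p v :=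
    DFunLike.congr_fun (differential_mul (f.contMDiff.mdifferentiable (by simp) p)
      (mdifferentiableAt_pairing μ Y p)) v
  have hbracket : pairing μ (L.bracket X (Y.fsmul f)) p = f p * pairing μ (L.bracket X Y) p +
      differential 𝓘(ℝ, E) f p (L.anchor p (X p)) * pairing μ Y p :=
    congrArg (fun Z : DualBundle W p => (Z (μ p) : ℝ)) (L.leibniz X f Y p)
  have hanchor : L.anchor p (Y.fsmul f p) = f p • L.anchor p (Y p) :=
    map_smul (L.anchor p) (f p) (Y p)
  simp only [extDeriv₁, hpairing, hbracket, hanchor, map_smul, smul_eq_mul]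
  ring

end ExteriorDerivative

section ExteriorDerivativeOfOne

variable {E : Type*} [NormedAddCommGroup E] [NormedSpace ℝ E]
  {M : Type*} [TopologicalSpace M] [ChartedSpace E M] [T2Space M]
  {F : Type*} [NormedAddCommGroup F] [NormedSpace ℝ F] [FiniteDimensional ℝ F]
  {V : M → Type*} [∀ p, AddCommGroup (V p)] [∀ p, Module ℝ (V p)]
  [∀ p, TopologicalSpace (V p)] [TopologicalSpace (TotalSpace F V)]
  [FiberBundle F V] [VectorBundle ℝ F V]
  {A : M → Type*} [∀ p, AddTorsor (V p) (A p)]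
  [∀ p, TopologicalSpace (A p)] [TopologicalSpace (TotalSpace F A)] [FiberBundle F A]
  [SmoothAffineBundle E F V A]

lemma exists_eq_fsmul_hullSection_add (α : Sec E F A)
    (X : Sec E (VectorHullModel F) (VectorHull E F V A)) : ∃ β : Sec E F A,
      X = (hullSection α).fsmul (smoothPairing (oneSection E F V A) X - 1) + hullSection β := by
  obtain ⟨β, hβ⟩ := exists_hullSection_eq
    (Z := X - (hullSection α).fsmul (smoothPairing (oneSection E F V A) X - 1)) fun p => by
      change pairing (oneSection E F V A) X p -
        (pairing (oneSection E F V A) X p - 1) * pairing (oneSection E F V A) (hullSection α) p = 1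
      rw [pairing_oneSection_hullSection]
      ring
  exact ⟨β, by rw [hβ]; abel⟩

omit [T2Space M] in
lemma extDeriv₁_oneSection_hullSection [IsManifold 𝓘(ℝ, E) 1 M]
    (L : LieAlgebroid E (VectorHullModel F) (VectorHull E F V A)) (α β : Sec E F A) (p : M) :
    extDeriv₁ L (oneSection E F V A) (hullSection α) (hullSection β) p =
      -pairing (oneSection E F V A) (L.bracket (hullSection α) (hullSection β)) p := by
  have hone (γ : Sec E F A) : pairing (oneSection E F V A) (hullSection γ) = fun _ => 1 :=
    pairing_oneSection_hullSection γ
  simp only [extDeriv₁, hone, differential_const, _root_.zero_apply, sub_zero, zero_sub]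

lemma extDeriv₁_oneSection_eq_zero_iff [FiniteDimensional ℝ E] [IsManifold 𝓘(ℝ, E) ∞ M]
    [SigmaCompactSpace M] {L : LieAlgebroid E (VectorHullModel F) (VectorHull E F V A)} :
    (∀ X Y p, extDeriv₁ L (oneSection E F V A) X Y p = 0) ↔
      ∀ (α β : Sec E F A) (p : M),
        pairing (oneSection E F V A) (L.bracket (hullSection α) (hullSection β)) p = 0 := by
  refine ⟨fun h α β p => ?_, fun h X Y p => ?_⟩
  · rw [← neg_eq_zero, ← extDeriv₁_oneSection_hullSection, h]
  obtain ⟨α⟩ := nonempty_affineSection E F V A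
  have hpoints (β γ : Sec E F A) :
      extDeriv₁ L (oneSection E F V A) (hullSection β) (hullSection γ) p = 0 := by
    rw [extDeriv₁_oneSection_hullSection, h, neg_zero]
  have hleft (β : Sec E F A) (Z : Sec E (VectorHullModel F) (VectorHull E F V A)) :
      extDeriv₁ L (oneSection E F V A) (hullSection β) Z p = 0 := by
    obtain ⟨γ, hγ⟩ := exists_eq_fsmul_hullSection_add α Z
    rw [hγ, extDeriv₁_add_right, extDeriv₁_fsmul_right, hpoints, hpoints, mul_zero, add_zero]
  have hright (β : Sec E F A) : extDeriv₁ L (oneSection E F V A) Y (hullSection β) p = 0 := by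
    rw [extDeriv₁_swap, hleft, neg_zero]
  obtain ⟨β, hβ⟩ := exists_eq_fsmul_hullSection_add α X
  rw [extDeriv₁_swap, hβ, extDeriv₁_add_right, extDeriv₁_fsmul_right, hright, hright, mul_zero,
    add_zero, neg_zero]

end ExteriorDerivativeOfOne

section TotalSpaces

variable {B H N : Type*} [NormedAddCommGroup B] [NormedSpace ℝ B] [TopologicalSpace H]
  {I : ModelWithCorners ℝ B H} [TopologicalSpace N] [ChartedSpace H N]
  {E : Type*} [NormedAddCommGroup E] [NormedSpace ℝ E]
  {M : Type*} [TopologicalSpace M] [ChartedSpace E M]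
  {G : Type*} [NormedAddCommGroup G] [NormedSpace ℝ G]
  {Z : M → Type*} [∀ p, TopologicalSpace (Z p)] [TopologicalSpace (TotalSpace G Z)]
  [FiberBundle G Z]

lemma extChartAt_totalSpace_apply {z z₀ : TotalSpace G Z}
    (hz : z.1 ∈ (trivializationAt G Z z₀.1).baseSet) :
    extChartAt (𝓘(ℝ, E).prod 𝓘(ℝ, G)) z₀ z =
      (extChartAt 𝓘(ℝ, E) z₀.1 z.1, (trivializationAt G Z z₀.1 z).2) := by
  rw [FiberBundle.extChartAt]
  exact Prod.ext (congrArg (extChartAt 𝓘(ℝ, E) z₀.1) (Trivialization.coe_fst' _ hz)) rfl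

lemma hasMFDerivAt_totalSpace {Φ : N → TotalSpace G Z} {x : N} {D : B →L[ℝ] E × G} :
    HasMFDerivAt I (𝓘(ℝ, E).prod 𝓘(ℝ, G)) Φ x D ↔
      HasMFDerivAt I 𝓘(ℝ, E) (fun y => (Φ y).1) x (ContinuousLinearMap.fst ℝ E G ∘L D) ∧
      HasMFDerivAt I 𝓘(ℝ, G) (fun y => (trivializationAt G Z (Φ x).1 (Φ y)).2) x
        (ContinuousLinearMap.snd ℝ E G ∘L D) := by
  simp only [HasMFDerivAt]
  rw [and_and_and_comm, ← FiberBundle.continuousAt_totalSpace G, and_congr_right_iff]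
  intro hΦ
  have hbase : (fun y => (Φ y).1) ⁻¹' (trivializationAt G Z (Φ x).1).baseSet ∈ 𝓝 x :=
    ((FiberBundle.continuousAt_totalSpace G Φ).1 hΦ).1.preimage_mem_nhds
      ((trivializationAt G Z (Φ x).1).open_baseSet.mem_nhds (mem_baseSet_trivializationAt G Z _))
  have hchart : writtenInExtChartAt I (𝓘(ℝ, E).prod 𝓘(ℝ, G)) x Φ
      =ᶠ[𝓝[range I] (extChartAt I x x)] fun y =>
        (writtenInExtChartAt I 𝓘(ℝ, E) x (fun y => (Φ y).1) y,
          writtenInExtChartAt I 𝓘(ℝ, G) x (fun y => (trivializationAt G Z (Φ x).1 (Φ y)).2) y) := by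
    filter_upwards [mem_nhdsWithin_of_mem_nhds (extChartAt_preimage_mem_nhds hbase)] with y hy
      using extChartAt_totalSpace_apply hy
  have hx := hchart.self_of_nhdsWithin (mem_range_self _)
  exact ⟨fun h => have h := h.congr_of_eventuallyEq hchart.symm hx.symm; ⟨h.fst, h.snd⟩,
    fun h => (h.1.prodMk h.2).congr_of_eventuallyEq hchart hx⟩

lemma hasMFDerivAt_of_affine_coord {F : Type*} [NormedAddCommGroup F] [NormedSpace ℝ F]
    {A : M → Type*} [∀ p, TopologicalSpace (A p)] [TopologicalSpace (TotalSpace F A)]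
    [FiberBundle F A] (Φ : ∀ p, A p → Z p) (a : TotalSpace F A) (J : F →L[ℝ] G) (c : G)
    (h : ∀ᶠ b : TotalSpace F A in 𝓝 a, (trivializationAt G Z a.1 ⟨b.1, Φ b.1 b.2⟩).2 =
      J (trivializationAt F A a.1 b).2 + c) :
    HasMFDerivAt (𝓘(ℝ, E).prod 𝓘(ℝ, F)) (𝓘(ℝ, E).prod 𝓘(ℝ, G))
      (fun b => (⟨b.1, Φ b.1 b.2⟩ : TotalSpace G Z)) a
      ((ContinuousLinearMap.fst ℝ E F).prod (J ∘L ContinuousLinearMap.snd ℝ E F) :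
        E × F →L[ℝ] E × G) := by
  obtain ⟨hproj, hcoord⟩ := hasMFDerivAt_totalSpace.1
    (hasMFDerivAt_id (I := 𝓘(ℝ, E).prod 𝓘(ℝ, F)) a)
  have haffine : HasMFDerivAt (𝓘(ℝ, E).prod 𝓘(ℝ, F)) 𝓘(ℝ, G)
      (fun b : TotalSpace F A => J (trivializationAt F A a.1 b).2 + c) a
      (J ∘L ContinuousLinearMap.snd ℝ E F) :=
    HasMFDerivAt.comp a (J.hasFDerivAt.add_const c).hasMFDerivAt hcoord
  exact hasMFDerivAt_totalSpace.2 ⟨hproj, haffine.congr_of_eventuallyEq h⟩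

end TotalSpaces

section ModelDerivative

variable {E : Type*} [NormedAddCommGroup E] [NormedSpace ℝ E]
  {M : Type*} [TopologicalSpace M] [ChartedSpace E M]
  {F : Type*} [NormedAddCommGroup F] [NormedSpace ℝ F] [FiniteDimensional ℝ F]
  {V : M → Type*} [∀ p, AddCommGroup (V p)] [∀ p, Module ℝ (V p)]
  [∀ p, TopologicalSpace (V p)] [TopologicalSpace (TotalSpace F V)]
  [FiberBundle F V] [VectorBundle ℝ F V]
  {A : M → Type*} [∀ p, AddTorsor (V p) (A p)]
  [∀ p, TopologicalSpace (A p)] [TopologicalSpace (TotalSpace F A)] [FiberBundle F A]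
  [SmoothAffineBundle E F V A]

lemma oneSection_coord_eventuallyEq (p : M) :
    (oneSection E F V A).coord p =ᶠ[𝓝 p] fun _ => (0, 1) := by
  filter_upwards [(trivializationAt F A p).open_baseSet.mem_nhds
    (mem_baseSet_trivializationAt F A p)] with q hq using oneSection_coord hq

variable [T2Space M]

lemma hasMFDerivAt_hullMap (a : TotalSpace F A) :
    HasMFDerivAt (𝓘(ℝ, E).prod 𝓘(ℝ, F)) (𝓘(ℝ, E).prod 𝓘(ℝ, VectorHullModel F))
      (hullMap E F V A) a ((ContinuousLinearMap.fst ℝ E F).prod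
        (hullModelVector F ∘L ContinuousLinearMap.snd ℝ E F) :
          E × F →L[ℝ] E × VectorHullModel F) := by
  have hbase : π F A ⁻¹' (trivializationAt F A a.1).baseSet ∈ 𝓝 a :=
    (FiberBundle.continuous_proj F A).continuousAt.preimage_mem_nhds
      ((trivializationAt F A a.1).open_baseSet.mem_nhds (mem_baseSet_trivializationAt F A a.1))
  refine hasMFDerivAt_of_affine_coord (Z := VectorHull E F V A) (fun p => hullPoint E F V (p := p))
    a _ (ContinuousLinearMap.snd ℝ (F →L[ℝ] ℝ) ℝ) ?_
  filter_upwards [hbase] with b hb using hullPoint_coord hb b.2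

lemma mem_range_mfderiv_hullMap_iff (a : TotalSpace F A) (v : E × VectorHullModel F) :
    v ∈ range (mfderiv (𝓘(ℝ, E).prod 𝓘(ℝ, F)) (𝓘(ℝ, E).prod 𝓘(ℝ, VectorHullModel F))
      (hullMap E F V A) a : E × F → E × VectorHullModel F) ↔ v.2 (0, 1) = 0 := by
  rw [(hasMFDerivAt_hullMap a).mfderiv]
  constructor
  · rintro ⟨u, rfl⟩
    exact (hullModelVector_apply u.2 (0, 1)).trans rfl
  · intro h
    refine ⟨(v.1, hullModelPoint F v.2), Prod.ext rfl ?_⟩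
    have hv := hullModelVector_hullModelPoint_add v.2
    rwa [h, zero_smul, add_zero] at hv

end ModelDerivative

section CompleteLifts

variable {E : Type*} [NormedAddCommGroup E] [NormedSpace ℝ E] [FiniteDimensional ℝ E]
  {M : Type*} [TopologicalSpace M] [ChartedSpace E M] [IsManifold 𝓘(ℝ, E) ∞ M] [T2Space M]
  {F : Type*} [NormedAddCommGroup F] [NormedSpace ℝ F] [FiniteDimensional ℝ F]

section VectorBundle

variable {W : M → Type*} [∀ p, AddCommGroup (W p)] [∀ p, Module ℝ (W p)]
  [∀ p, TopologicalSpace (W p)] [TopologicalSpace (TotalSpace F W)]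
  [FiberBundle F W] [VectorBundle ℝ F W] [ContMDiffVectorBundle ∞ F W 𝓘(ℝ, E)]
  (L : LieAlgebroid E (F →L[ℝ] ℝ) (DualBundle W))

lemma differential_linearFunDual_of_coord_eventuallyEq {μ : Sec E F W} {c : F}
    {e : TotalSpace (F →L[ℝ] ℝ) (DualBundle W)} (h : μ.coord e.1 =ᶠ[𝓝 e.1] fun _ => c)
    (v : E × (F →L[ℝ] ℝ)) :
    differential (𝓘(ℝ, E).prod 𝓘(ℝ, F →L[ℝ] ℝ)) (linearFunDual μ) e v = v.2 c := by
  have hd : μ.dcoord e.1 = 0 := h.mfderiv_eq.trans mfderiv_const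
  rw [differential_linearFunDual, hd, h.self_of_nhds, zero_apply, map_zero, add_zero]

lemma isCompleteLiftAt_completeLift (X : Sec E (F →L[ℝ] ℝ) (DualBundle W))
    (e : TotalSpace (F →L[ℝ] ℝ) (DualBundle W)) : IsCompleteLiftAt L X e (completeLift L X e) :=
  (existsUnique_isCompleteLiftAt L X e).choose_spec.1

end VectorBundle

variable {V : M → Type*} [∀ p, AddCommGroup (V p)] [∀ p, Module ℝ (V p)]
  [∀ p, TopologicalSpace (V p)] [TopologicalSpace (TotalSpace F V)]
  [FiberBundle F V] [VectorBundle ℝ F V]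
  {A : M → Type*} [∀ p, AddTorsor (V p) (A p)]
  [∀ p, TopologicalSpace (A p)] [TopologicalSpace (TotalSpace F A)] [FiberBundle F A]
  [SmoothAffineBundle E F V A]
  (L : LieAlgebroid E (VectorHullModel F) (VectorHull E F V A))

omit [FiniteDimensional ℝ E] [T2Space M] in
lemma lieDeriv₁_oneSection_hullSection (X : Sec E (VectorHullModel F) (VectorHull E F V A))
    (β : Sec E F A) (p : M) :
    lieDeriv₁ L X (oneSection E F V A) (hullSection β) p =
      -pairing (oneSection E F V A) (L.bracket X (hullSection β)) p := by
  rw [lieDeriv₁, pairing_oneSection_hullSection, differential_const]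
  exact zero_sub _

lemma completeLift_mem_range_mfderiv_hullMap_iff
    (X : Sec E (VectorHullModel F) (VectorHull E F V A)) (β : Sec E F A) (p : M) :
    completeLift L X (hullMap E F V A ⟨p, β p⟩) ∈
        range (mfderiv (𝓘(ℝ, E).prod 𝓘(ℝ, F)) (𝓘(ℝ, E).prod 𝓘(ℝ, VectorHullModel F))
          (hullMap E F V A) ⟨p, β p⟩) ↔
      pairing (oneSection E F V A) (L.bracket X (hullSection β)) p = 0 := by
  have hcoord := differential_linearFunDual_of_coord_eventuallyEq
    (e := hullMap E F V A ⟨p, β p⟩) (oneSection_coord_eventuallyEq p)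
    (completeLift L X (hullMap E F V A ⟨p, β p⟩))
  have hlie := (isCompleteLiftAt_completeLift L X (hullMap E F V A ⟨p, β p⟩)).linear
    (oneSection E F V A) (hullSection β) rfl
  have hone : (completeLift L X (hullMap E F V A ⟨p, β p⟩)).2 (0, 1) =
      lieDeriv₁ L X (oneSection E F V A) (hullSection β) p := hcoord.symm.trans hlie
  rw [← neg_eq_zero, ← lieDeriv₁_oneSection_hullSection, ← hone]
  exact mem_range_mfderiv_hullMap_iff ⟨p, β p⟩ _

lemma completeLift_tangent_iff [SigmaCompactSpace M] [ContMDiffVectorBundle ∞ F V 𝓘(ℝ, E)] :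
    (∀ (α : Sec E F A) (a : TotalSpace F A),
        completeLift L (hullSection α) (hullMap E F V A a) ∈
          range (mfderiv (𝓘(ℝ, E).prod 𝓘(ℝ, F)) (𝓘(ℝ, E).prod 𝓘(ℝ, VectorHullModel F))
            (hullMap E F V A) a)) ↔
      ∀ X Y p, extDeriv₁ L (oneSection E F V A) X Y p = 0 := by
  rw [extDeriv₁_oneSection_eq_zero_iff]
  refine ⟨fun h α β p => (completeLift_mem_range_mfderiv_hullMap_iff L _ β p).1 (h α _), ?_⟩
  rintro h α ⟨p, a⟩
  obtain ⟨β, rfl⟩ := exists_affineSection_eq (E := E) (F := F) (V := V) a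
  exact (completeLift_mem_range_mfderiv_hullMap_iff L _ β p).2 (h α β p)

end CompleteLifts

section BivectorFields

variable {B H N : Type*} [NormedAddCommGroup B] [NormedSpace ℝ B] [TopologicalSpace H]
  {I : ModelWithCorners ℝ B H} [TopologicalSpace N] [ChartedSpace H N] {ι : Type} [Fintype ι]

/-- Near `w` one has `df = ∑ i, aᵢ dxᵢ`, with coefficients differentiable at `w`, where moreover
`∑ i, dxᵢ ∧ daᵢ = 0`. This is the first-order expansion of `df` through which a second-order
expression in `f` at `w` is reduced to the functions `xᵢ`. -/
structure IsDifferentialExpansionAt (I : ModelWithCorners ℝ B H) (x a : ι → N → ℝ) (f : N → ℝ)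
    (w : N) : Prop where
  mdifferentiableAt : ∀ i, MDifferentiableAt I 𝓘(ℝ, ℝ) (a i) w
  eventuallyEq : ∀ᶠ y in 𝓝 w, differential I f y = ∑ i, a i y • differential I (x i) y
  closed : ∀ D D' : Cotangent I w →ₗ[ℝ] ℝ,
    ∑ i, D (differential I (x i) w) * D' (differential I (a i) w) =
      ∑ i, D' (differential I (x i) w) * D (differential I (a i) w)

namespace IsDifferentialExpansionAt

variable {x a : ι → N → ℝ} {f : N → ℝ} {w : N} {D D' : ∀ y : N, Cotangent I y →ₗ[ℝ] ℝ}

lemma hasMFDerivAt_apply (h : IsDifferentialExpansionAt I x a f w)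
    (hD : ∀ i, MDifferentiableAt I 𝓘(ℝ, ℝ) (fun y => D y (differential I (x i) y)) w) :
    HasMFDerivAt I 𝓘(ℝ, ℝ) (fun y => D y (differential I f y)) w
      (∑ i, (a i w • differential I (fun y => D y (differential I (x i) y)) w +
        D w (differential I (x i) w) • differential I (a i) w) : Cotangent I w) := by
  have hsum : HasMFDerivAt I 𝓘(ℝ, ℝ) (∑ i, a i * fun y => D y (differential I (x i) y)) w
      (∑ i, (a i w • differential I (fun y => D y (differential I (x i) y)) w +
        D w (differential I (x i) w) • differential I (a i) w) : Cotangent I w) :=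
    HasMFDerivAt.sum fun i _ => (h.mdifferentiableAt i).hasMFDerivAt.mul (hD i).hasMFDerivAt
  refine hsum.congr_of_eventuallyEq ?_
  filter_upwards [h.eventuallyEq] with y hy
  simp only [hy, map_sum, map_smul, smul_eq_mul, Finset.sum_apply, Pi.mul_apply]

lemma commutator_eq_sum (h : IsDifferentialExpansionAt I x a f w)
    (hD : ∀ i, MDifferentiableAt I 𝓘(ℝ, ℝ) (fun y => D y (differential I (x i) y)) w)
    (hD' : ∀ i, MDifferentiableAt I 𝓘(ℝ, ℝ) (fun y => D' y (differential I (x i) y)) w) :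
    D' w (differential I (fun y => D y (differential I f y)) w) -
        D w (differential I (fun y => D' y (differential I f y)) w) =
      ∑ i, a i w * (D' w (differential I (fun y => D y (differential I (x i) y)) w) -
        D w (differential I (fun y => D' y (differential I (x i) y)) w)) := by
  have hf : differential I (fun y => D y (differential I f y)) w = _ :=
    (h.hasMFDerivAt_apply hD).mfderiv
  have hf' : differential I (fun y => D' y (differential I f y)) w = _ :=
    (h.hasMFDerivAt_apply hD').mfderiv
  simp only [hf, hf', map_sum, map_add, map_smul, smul_eq_mul, Finset.sum_add_distrib,
    h.closed (D w) (D' w), mul_sub, Finset.sum_sub_distrib]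
  ring

variable {ζ : ∀ y : N, TangentSpace I y} {Λ : ∀ y : N, Cotangent I y →ₗ[ℝ] Cotangent I y →ₗ[ℝ] ℝ}

lemma lieDerivBivector_eq_sum {g : N → ℝ} (h : IsDifferentialExpansionAt I x a f w)
    (hζ : ∀ i, MDifferentiableAt I 𝓘(ℝ, ℝ) (fun y => differential I (x i) y (ζ y)) w)
    (hΛ : ∀ i, MDifferentiableAt I 𝓘(ℝ, ℝ)
      (fun y => Λ y (differential I (x i) y) (differential I g y)) w) :
    lieDerivBivector I ζ Λ f g w = ∑ i, a i w * lieDerivBivector I ζ Λ (x i) g w := by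
  have hcommutator := h.commutator_eq_sum (D := fun y => (Λ y).flip (differential I g y))
    (D' := fun y => (ContinuousLinearMap.coeLM ℝ).flip (ζ y)) hΛ hζ
  have hvalue : Λ w (differential I f w) (differential I (fun y => differential I g y (ζ y)) w) =
      ∑ i, a i w * Λ w (differential I (x i) w)
        (differential I (fun y => differential I g y (ζ y)) w) := by
    rw [h.eventuallyEq.self_of_nhds]
    simp only [map_sum, map_smul, LinearMap.sum_apply, LinearMap.smul_apply, smul_eq_mul]
  simp only [lieDerivBivector, mul_sub _ (_ - _), Finset.sum_sub_distrib, hvalue]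
  exact congrArg (· - _) hcommutator

end IsDifferentialExpansionAt

lemma lieDerivBivector_swap {ζ : ∀ y : N, TangentSpace I y}
    {Λ : ∀ y : N, Cotangent I y →ₗ[ℝ] Cotangent I y →ₗ[ℝ] ℝ} (hskew : ∀ y ξ η, Λ y ξ η = -Λ y η ξ)
    (f g : N → ℝ) (w : N) : lieDerivBivector I ζ Λ f g w = -lieDerivBivector I ζ Λ g f w := by
  have hfg : differential I (fun y => Λ y (differential I f y) (differential I g y)) w =
      -differential I (fun y => Λ y (differential I g y) (differential I f y)) w := by
    rw [funext fun y => hskew y (differential I f y) (differential I g y)]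
    exact mfderiv_neg ..
  rw [lieDerivBivector, lieDerivBivector, hfg, hskew w (differential I f w),
    hskew w _ (differential I g w), _root_.neg_apply]
  ring

section Coordinates

variable [FiniteDimensional ℝ B] (b : Module.Basis ι ℝ B) {w : N}

lemma differential_comp_extChartAt [IsManifold I 1 N] {G : B → ℝ} {y : N}
    (hy : y ∈ (extChartAt I w).source) (hG : DifferentiableAt ℝ G (extChartAt I w y)) :
    differential I (G ∘ extChartAt I w) y = ∑ i, fderiv ℝ G (extChartAt I w y) (b i) •
      differential I (LinearMap.toContinuousLinearMap (b.coord i) ∘ extChartAt I w) y := by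
  have hchart : MDifferentiableAt I 𝓘(ℝ, B) (extChartAt I w) y :=
    mdifferentiableAt_extChartAt (by rwa [extChartAt_source] at hy)
  have hcomp {K : B → ℝ} (hK : DifferentiableAt ℝ K (extChartAt I w y))
      (v : TangentSpace I y) : differential I (K ∘ extChartAt I w) y v =
        fderiv ℝ K (extChartAt I w y) (mfderiv I 𝓘(ℝ, B) (extChartAt I w) y v : B) :=
    DFunLike.congr_fun (hK.hasFDerivAt.hasMFDerivAt.comp y hchart.hasMFDerivAt).mfderiv v
  refine ContinuousLinearMap.ext fun v => ?_
  rw [hcomp hG, sum_apply]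
  conv_lhs => rw [← b.sum_repr (mfderiv I 𝓘(ℝ, B) (extChartAt I w) y v : B), map_sum]
  refine Finset.sum_congr rfl fun i _ => ?_
  rw [map_smul, smul_eq_mul, mul_comm, FunLike.coe_smul, Pi.smul_apply, smul_eq_mul,
    hcomp (ContinuousLinearMap.differentiableAt _), ContinuousLinearMap.fderiv]
  rfl

variable [IsManifold I ∞ N] [I.Boundaryless]

lemma exists_isDifferentialExpansionAt {f : N → ℝ} (hf : ContMDiff I 𝓘(ℝ, ℝ) ∞ f)
    {x : ι → N → ℝ}
    (hx : ∀ i, x i =ᶠ[𝓝 w] LinearMap.toContinuousLinearMap (b.coord i) ∘ extChartAt I w) :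
    ∃ a, IsDifferentialExpansionAt I x a f w := by
  let G : B → ℝ := f ∘ (extChartAt I w).symm
  have hG {z : B} (hz : z ∈ (extChartAt I w).target) : ContDiffAt ℝ ∞ G z :=
    contMDiffAt_iff_contDiffAt.1 (hf.contMDiffAt.comp z
      ((contMDiffOn_extChartAt_symm w).contMDiffAt (extChartAt_target_mem_nhds' hz)))
  have hfG {y : N} (hy : y ∈ (extChartAt I w).source) : f =ᶠ[𝓝 y] G ∘ extChartAt I w := by
    filter_upwards [(isOpen_extChartAt_source w).mem_nhds hy] with z hz
    simp only [G, Function.comp_apply, (extChartAt I w).left_inv hz]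
  have hdx : ∀ᶠ y in 𝓝 w, ∀ i, differential I (x i) y =
      differential I (LinearMap.toContinuousLinearMap (b.coord i) ∘ extChartAt I w) y :=
    Filter.eventually_all.2 fun i => (hx i).eventuallyEq_nhds.mono fun y hy => differential_congr hy
  have hchart : MDifferentiableAt I 𝓘(ℝ, B) (extChartAt I w) w :=
    mdifferentiableAt_extChartAt (mem_chart_source H w)
  have hw := mem_extChartAt_source (I := I) w
  have hGw := hG (mem_extChartAt_target w)
  have hG' : DifferentiableAt ℝ (fderiv ℝ G) (extChartAt I w w) :=
    (hGw.fderiv_right (m := 1) (by norm_cast)).differentiableAt one_ne_zero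
  have hpartial (i : ι) : HasFDerivAt (fun z => fderiv ℝ G z (b i))
      ((ContinuousLinearMap.apply ℝ ℝ (b i)).comp (fderiv ℝ (fderiv ℝ G) (extChartAt I w w)))
      (extChartAt I w w) :=
    (ContinuousLinearMap.apply ℝ ℝ (b i)).hasFDerivAt.comp _ hG'.hasFDerivAt
  have hsymm := hGw.isSymmSndFDerivAt (by rw [minSmoothness_of_isRCLikeNormedField]; norm_cast)
  refine ⟨fun i => (fun z => fderiv ℝ G z (b i)) ∘ extChartAt I w,
    fun i => ((hpartial i).hasMFDerivAt.comp w hchart.hasMFDerivAt).mdifferentiableAt, ?_,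
    fun D D' => ?_⟩
  · filter_upwards [extChartAt_source_mem_nhds (I := I) w, hdx] with y hy hxy
    simp only [hxy]
    rw [differential_congr (hfG hy)]
    exact differential_comp_extChartAt b hy
      ((hG ((extChartAt I w).map_source hy)).differentiableAt (by simp))
  · simp only [hdx.self_of_nhds,
      differential_comp_extChartAt b hw (hpartial _).differentiableAt, (hpartial _).fderiv,
      map_sum, map_smul, smul_eq_mul, Finset.mul_sum, ContinuousLinearMap.comp_apply,
      ContinuousLinearMap.apply_apply]
    rw [Finset.sum_comm]
    refine Finset.sum_congr rfl fun i _ => Finset.sum_congr rfl fun j _ => ?_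
    rw [hsymm (b i) (b j)]
    ring

lemma lieDerivBivector_eq_zero_of_coordinates {ζ : ∀ y : N, TangentSpace I y}
    {Λ : ∀ y : N, Cotangent I y →ₗ[ℝ] Cotangent I y →ₗ[ℝ] ℝ} (hskew : ∀ y ξ η, Λ y ξ η = -Λ y η ξ)
    {x : ι → N → ℝ}
    (hx : ∀ i, x i =ᶠ[𝓝 w] LinearMap.toContinuousLinearMap (b.coord i) ∘ extChartAt I w)
    (hζ : ∀ i, MDifferentiableAt I 𝓘(ℝ, ℝ) (fun y => differential I (x i) y (ζ y)) w)
    (hΛ : ∀ i j, MDifferentiableAt I 𝓘(ℝ, ℝ)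
      (fun y => Λ y (differential I (x i) y) (differential I (x j) y)) w)
    (hcoordinates : ∀ i j, lieDerivBivector I ζ Λ (x i) (x j) w = 0)
    {f g : N → ℝ} (hf : ContMDiff I 𝓘(ℝ, ℝ) ∞ f) (hg : ContMDiff I 𝓘(ℝ, ℝ) ∞ g) :
    lieDerivBivector I ζ Λ f g w = 0 := by
  obtain ⟨a, ha⟩ := exists_isDifferentialExpansionAt b hf hx
  obtain ⟨c, hc⟩ := exists_isDifferentialExpansionAt b hg hx
  have hΛg (i : ι) : MDifferentiableAt I 𝓘(ℝ, ℝ)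
      (fun y => Λ y (differential I (x i) y) (differential I g y)) w :=
    (hc.hasMFDerivAt_apply (D := fun y => Λ y (differential I (x i) y)) (hΛ i)).mdifferentiableAt
  have hxg (i : ι) : lieDerivBivector I ζ Λ (x i) g w = 0 := by
    rw [lieDerivBivector_swap hskew, hc.lieDerivBivector_eq_sum hζ fun j => hΛ j i]
    simp only [hcoordinates, mul_zero, Finset.sum_const_zero, neg_zero]
  rw [ha.lieDerivBivector_eq_sum hζ hΛg]
  simp only [hxg, mul_zero, Finset.sum_const_zero]

end Coordinates

end BivectorFields

section LinearFunctions

variable {E : Type*} [NormedAddCommGroup E] [NormedSpace ℝ E]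
  {M : Type*} [TopologicalSpace M] [ChartedSpace E M]
  {F : Type*} [NormedAddCommGroup F] [NormedSpace ℝ F]
  {W : M → Type*} [∀ p, AddCommGroup (W p)] [∀ p, Module ℝ (W p)]
  [∀ p, TopologicalSpace (W p)] [TopologicalSpace (TotalSpace F W)]
  [FiberBundle F W] [VectorBundle ℝ F W] (μ : Sec E F W)

lemma verticalLift_eq (w : TotalSpace F W) :
    verticalLift μ w = ((0, μ.coord w.1 w.1) : E × F) := by
  set e := trivializationAt F W w.1
  have hlin := e.linear ℝ (mem_baseSet_trivializationAt F W w.1)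
  have hcoord (t : ℝ) : (e ⟨w.1, w.2 + t • μ w.1⟩).2 = (e w).2 + t • μ.coord w.1 w.1 := by
    rw [hlin.map_add, hlin.map_smul]
    rfl
  have hline : HasDerivAt (fun t : ℝ => (e ⟨w.1, w.2 + t • μ w.1⟩).2) (μ.coord w.1 w.1) 0 := by
    simp only [hcoord]
    simpa only [one_smul] using
      ((hasDerivAt_id' (0 : ℝ)).smul_const (μ.coord w.1 w.1)).const_add (e w).2
  have hcurve : HasMFDerivAt 𝓘(ℝ, ℝ) (𝓘(ℝ, E).prod 𝓘(ℝ, F))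
      (fun t : ℝ => (⟨w.1, w.2 + t • μ w.1⟩ : TotalSpace F W)) 0
      (ContinuousLinearMap.toSpanSingleton ℝ ((0, μ.coord w.1 w.1) : E × F)) := by
    have hfst : (ContinuousLinearMap.fst ℝ E F).comp
        (ContinuousLinearMap.toSpanSingleton ℝ (0, μ.coord w.1 w.1)) = 0 := by
      ext
      simp
    have hsnd : (ContinuousLinearMap.snd ℝ E F).comp
        (ContinuousLinearMap.toSpanSingleton ℝ (0, μ.coord w.1 w.1)) =
          ContinuousLinearMap.toSpanSingleton ℝ (μ.coord w.1 w.1) := by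
      ext
      simp
    refine hasMFDerivAt_totalSpace.2 ⟨?_, ?_⟩
    · exact hfst ▸ hasMFDerivAt_const w.1 (0 : ℝ)
    · exact hsnd ▸ hline.hasFDerivAt.hasMFDerivAt
  rw [verticalLift, hcurve.mfderiv]
  exact one_smul ℝ ((0, μ.coord w.1 w.1) : E × F)

variable (X : Sec E (F →L[ℝ] ℝ) (DualBundle W)) (f : C^∞⟮𝓘(ℝ, E), M; ℝ⟯)

/-- The fibrewise affine function `ι_X + f ∘ π` on `W`. -/
def affineFun (w : TotalSpace F W) : ℝ := linearFun X w + f w.1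

variable [T2Space M] [FiniteDimensional ℝ F]

lemma contMDiff_linearFun :
    ContMDiff (𝓘(ℝ, E).prod 𝓘(ℝ, F)) 𝓘(ℝ, ℝ) ∞ (linearFun X) := by
  intro w
  have hid := (contMDiffAt_totalSpace (F := F) (E := W)).1
    (contMDiffAt_id (I := 𝓘(ℝ, E).prod 𝓘(ℝ, F)) (n := ∞) (x := w))
  have hX := ((contMDiffAt_section (n := ∞) w.1).1 (X.contMDiff w.1)).comp w hid.1
  refine (hX.clm_apply hid.2).congr_of_eventuallyEq ?_
  have hbase : π F W ⁻¹' (trivializationAt F W w.1).baseSet ∈ 𝓝 w :=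
    (FiberBundle.continuous_proj F W).continuousAt.preimage_mem_nhds
      ((trivializationAt F W w.1).open_baseSet.mem_nhds (mem_baseSet_trivializationAt F W w.1))
  filter_upwards [hbase] with z hz using dual_apply_eq hz _ _

lemma contMDiff_affineFun :
    ContMDiff (𝓘(ℝ, E).prod 𝓘(ℝ, F)) 𝓘(ℝ, ℝ) ∞ (affineFun X f : TotalSpace F W → ℝ) :=
  (contMDiff_linearFun X).add (f.contMDiff.comp (contMDiff_proj W))

lemma differential_affineFun (w : TotalSpace F W) :
    differential (𝓘(ℝ, E).prod 𝓘(ℝ, F)) (affineFun X f) w =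
      differential (𝓘(ℝ, E).prod 𝓘(ℝ, F)) (linearFun X) w +
        differential (𝓘(ℝ, E).prod 𝓘(ℝ, F)) (f ∘ π F W) w :=
  differential_add ((contMDiff_linearFun X).mdifferentiable (by simp) w)
    ((f.contMDiff.comp (contMDiff_proj W)).mdifferentiable (by simp) w)

variable [FiniteDimensional ℝ E] [IsManifold 𝓘(ℝ, E) ∞ M] [ContMDiffVectorBundle ∞ F W 𝓘(ℝ, E)]

lemma differential_linearFun_verticalLift (w : TotalSpace F W) :
    differential (𝓘(ℝ, E).prod 𝓘(ℝ, F)) (linearFun X) w (verticalLift μ w) =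
      pairing μ X w.1 := by
  rw [verticalLift_eq]
  refine (differential_linearFun X w _).trans ?_
  rw [map_zero, zero_apply, zero_add]
  exact (dual_apply_eq (mem_baseSet_trivializationAt F W w.1) _ _).symm

lemma differential_comp_proj_verticalLift (w : TotalSpace F W) :
    differential (𝓘(ℝ, E).prod 𝓘(ℝ, F)) (f ∘ π F W) w (verticalLift μ w) = 0 := by
  rw [verticalLift_eq]
  exact (differential_comp_proj f w _).trans (map_zero _)

lemma differential_affineFun_verticalLift (w : TotalSpace F W) :
    differential (𝓘(ℝ, E).prod 𝓘(ℝ, F)) (affineFun X f) w (verticalLift μ w) =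
      pairing μ X w.1 := by
  rw [differential_affineFun, _root_.add_apply, differential_linearFun_verticalLift,
    differential_comp_proj_verticalLift, add_zero]

end LinearFunctions

section CoordinateFunctions

variable {E : Type*} [NormedAddCommGroup E] [NormedSpace ℝ E] [FiniteDimensional ℝ E]
  {M : Type*} [TopologicalSpace M] [ChartedSpace E M] [IsManifold 𝓘(ℝ, E) ∞ M] [T2Space M]
  {F : Type*} [NormedAddCommGroup F] [NormedSpace ℝ F] [FiniteDimensional ℝ F]
  {W : M → Type*} [∀ p, AddCommGroup (W p)] [∀ p, Module ℝ (W p)]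
  [∀ p, TopologicalSpace (W p)] [TopologicalSpace (TotalSpace F W)]
  [FiberBundle F W] [VectorBundle ℝ F W] [ContMDiffVectorBundle ∞ F W 𝓘(ℝ, E)]

lemma exists_eventuallyEq_extChartAt (p : M) (ξ : E →L[ℝ] ℝ) :
    ∃ f : C^∞⟮𝓘(ℝ, E), M; ℝ⟯, f =ᶠ[𝓝 p] ξ ∘ extChartAt 𝓘(ℝ, E) p := by
  obtain ⟨b, hb_one, hb_support⟩ :=
    exists_bump (E := E) p (chartAt E p).source (chart_source_mem_nhds E p)
  have hsmooth : ContMDiff 𝓘(ℝ, E) 𝓘(ℝ, ℝ) ∞ (fun q => b q * ξ (extChartAt 𝓘(ℝ, E) p q)) :=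
    contMDiff_of_tsupport fun q hq => b.contMDiff.contMDiffAt.mul
      (ξ.contMDiff.contMDiffAt.comp q
        (contMDiffAt_extChartAt' (hb_support (tsupport_mul_subset_left hq))))
  refine ⟨⟨_, hsmooth⟩, ?_⟩
  filter_upwards [hb_one] with q hq
  exact (congrArg (· * ξ (extChartAt 𝓘(ℝ, E) p q)) hq).trans (one_mul _)

lemma exists_affineFun_eventuallyEq_extChartAt (w : TotalSpace F W) (ξ : E × F →L[ℝ] ℝ) :
    ∃ (X : Sec E (F →L[ℝ] ℝ) (DualBundle W)) (f : C^∞⟮𝓘(ℝ, E), M; ℝ⟯),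
      affineFun X f =ᶠ[𝓝 w] ξ ∘ extChartAt (𝓘(ℝ, E).prod 𝓘(ℝ, F)) w := by
  obtain ⟨X, hX⟩ := exists_coord_eventuallyEq (E := E) (F := F →L[ℝ] ℝ) (V := DualBundle W) w.1
    (ξ ∘L ContinuousLinearMap.inr ℝ E F)
  obtain ⟨f, hf⟩ := exists_eventuallyEq_extChartAt w.1 (ξ ∘L ContinuousLinearMap.inl ℝ E F)
  have hproj : Filter.Tendsto (π F W) (𝓝 w) (𝓝 w.1) :=
    (FiberBundle.continuous_proj F W).continuousAt
  refine ⟨X, f, ?_⟩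
  filter_upwards [hproj.eventually hX, hproj.eventually hf, hproj.eventually
    ((trivializationAt F W w.1).open_baseSet.mem_nhds
      (mem_baseSet_trivializationAt F W w.1))] with z hXz hfz hz
  have hlinear : linearFun X z = ξ (0, (trivializationAt F W w.1 z).2) :=
    (dual_apply_eq hz _ _).trans
      (congrArg (fun γ : F →L[ℝ] ℝ => γ (trivializationAt F W w.1 z).2) hXz)
  have hbasic : f z.1 = ξ (extChartAt 𝓘(ℝ, E) w.1 z.1, 0) := hfz
  rw [affineFun, hlinear, hbasic, Function.comp_apply, extChartAt_totalSpace_apply hz, ← map_add,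
    Prod.mk_add_mk, zero_add, add_zero]

end CoordinateFunctions

section LinearPoissonTensor

variable {E : Type*} [NormedAddCommGroup E] [NormedSpace ℝ E] [FiniteDimensional ℝ E]
  {M : Type*} [TopologicalSpace M] [ChartedSpace E M] [IsManifold 𝓘(ℝ, E) ∞ M] [T2Space M]
  {F : Type*} [NormedAddCommGroup F] [NormedSpace ℝ F] [FiniteDimensional ℝ F]
  {W : M → Type*} [∀ p, AddCommGroup (W p)] [∀ p, Module ℝ (W p)]
  [∀ p, TopologicalSpace (W p)] [TopologicalSpace (TotalSpace F W)]
  [FiberBundle F W] [VectorBundle ℝ F W] [ContMDiffVectorBundle ∞ F W 𝓘(ℝ, E)]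
  (L : LieAlgebroid E (F →L[ℝ] ℝ) (DualBundle W))

omit [FiniteDimensional ℝ E] [T2Space M] [FiniteDimensional ℝ F]
  [ContMDiffVectorBundle ∞ F W 𝓘(ℝ, E)] in
lemma IsLinearPoissonAt.skew {L : LieAlgebroid E (F →L[ℝ] ℝ) (DualBundle W)} {w : TotalSpace F W}
    {Λ : Cotangent (𝓘(ℝ, E).prod 𝓘(ℝ, F)) w →ₗ[ℝ] Cotangent (𝓘(ℝ, E).prod 𝓘(ℝ, F)) w →ₗ[ℝ] ℝ}
    (h : IsLinearPoissonAt L w Λ) (ξ η : Cotangent (𝓘(ℝ, E).prod 𝓘(ℝ, F)) w) :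
    Λ ξ η = -Λ η ξ :=
  (LinearMap.IsAlt.neg h.alternating η ξ).symm

lemma isLinearPoissonAt_linearPoissonTensor (w : TotalSpace F W) :
    IsLinearPoissonAt L w (linearPoissonTensor L w) :=
  (existsUnique_isLinearPoissonAt L w).choose_spec.1

/-- The derivative `ρ(X)(f)` of `f` along the anchor of `X`, as an element of `C^∞(M)`. -/
def anchorDeriv (X : Sec E (F →L[ℝ] ℝ) (DualBundle W)) (f : C^∞⟮𝓘(ℝ, E), M; ℝ⟯) :
    C^∞⟮𝓘(ℝ, E), M; ℝ⟯ :=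
  ⟨fun p => differential 𝓘(ℝ, E) f p (L.anchor p (X p)),
    (contMDiff_snd_tangentBundle_modelSpace ℝ 𝓘(ℝ, ℝ)).comp
      ((f.contMDiff.contMDiff_tangentMap (m := ∞) (by norm_cast)).comp
        (L.contMDiff_anchor.comp X.contMDiff))⟩

variable (X Y : Sec E (F →L[ℝ] ℝ) (DualBundle W)) (f g : C^∞⟮𝓘(ℝ, E), M; ℝ⟯)

lemma linearPoissonTensor_affineFun (w : TotalSpace F W) :
    linearPoissonTensor L w (differential (𝓘(ℝ, E).prod 𝓘(ℝ, F)) (affineFun X f) w)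
        (differential (𝓘(ℝ, E).prod 𝓘(ℝ, F)) (affineFun Y g) w) =
      affineFun (L.bracket X Y) (anchorDeriv L X g - anchorDeriv L Y f) w := by
  have hΛ := isLinearPoissonAt_linearPoissonTensor L w
  rw [differential_affineFun, differential_affineFun]
  simp only [map_add, LinearMap.add_apply]
  rw [hΛ.linear_linear, hΛ.linear_basic, hΛ.basic_basic,
    hΛ.skew (differential (𝓘(ℝ, E).prod 𝓘(ℝ, F)) (f ∘ π F W) w), hΛ.linear_basic]
  change _ = _ + (differential 𝓘(ℝ, E) g w.1 (L.anchor w.1 (X w.1)) -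
    differential 𝓘(ℝ, E) f w.1 (L.anchor w.1 (Y w.1)))
  ring

lemma lieDerivBivector_verticalLift_affineFun (μ : Sec E F W) (w : TotalSpace F W) :
    lieDerivBivector (𝓘(ℝ, E).prod 𝓘(ℝ, F)) (verticalLift μ) (linearPoissonTensor L)
      (affineFun X f) (affineFun Y g) w = -extDeriv₁ L μ X Y w.1 := by
  have hΛ := isLinearPoissonAt_linearPoissonTensor L w
  have hlift (Z : Sec E (F →L[ℝ] ℝ) (DualBundle W)) (h : C^∞⟮𝓘(ℝ, E), M; ℝ⟯) :
      (fun y => differential (𝓘(ℝ, E).prod 𝓘(ℝ, F)) (affineFun Z h) y (verticalLift μ y)) =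
        smoothPairing μ Z ∘ π F W := funext (differential_affineFun_verticalLift μ Z h)
  have hmixed (Z : Sec E (F →L[ℝ] ℝ) (DualBundle W)) (h k : C^∞⟮𝓘(ℝ, E), M; ℝ⟯) :
      linearPoissonTensor L w (differential (𝓘(ℝ, E).prod 𝓘(ℝ, F)) (affineFun Z h) w)
        (differential (𝓘(ℝ, E).prod 𝓘(ℝ, F)) (k ∘ π F W) w) =
          differential 𝓘(ℝ, E) k w.1 (L.anchor w.1 (Z w.1)) := by
    rw [differential_affineFun, map_add, LinearMap.add_apply, hΛ.linear_basic, hΛ.basic_basic,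
      add_zero]
  rw [lieDerivBivector, funext (linearPoissonTensor_affineFun L X Y f g),
    differential_affineFun_verticalLift, hlift, hlift, hΛ.skew, hmixed, hmixed]
  change _ - -differential 𝓘(ℝ, E) (pairing μ X) w.1 (L.anchor w.1 (Y w.1)) -
    differential 𝓘(ℝ, E) (pairing μ Y) w.1 (L.anchor w.1 (X w.1)) = _
  rw [extDeriv₁]
  ring

theorem lieDerivBivector_verticalLift_eq_zero_iff (μ : Sec E F W) :
    (∀ (f g : C^∞⟮𝓘(ℝ, E).prod 𝓘(ℝ, F), TotalSpace F W; ℝ⟯) (w : TotalSpace F W),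
        lieDerivBivector (𝓘(ℝ, E).prod 𝓘(ℝ, F)) (verticalLift μ) (linearPoissonTensor L)
          f g w = 0) ↔
      ∀ (X Y : Sec E (F →L[ℝ] ℝ) (DualBundle W)) (p : M), extDeriv₁ L μ X Y p = 0 := by
  constructor
  · intro h X Y p
    have hlift := lieDerivBivector_verticalLift_affineFun L X Y 0 0 μ ⟨p, 0⟩
    exact neg_eq_zero.1 (hlift.symm.trans
      (h ⟨_, contMDiff_affineFun X 0⟩ ⟨_, contMDiff_affineFun Y 0⟩ ⟨p, 0⟩))
  · intro h f g w
    let b := Module.finBasis ℝ (E × F)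
    choose X k hXk using fun i =>
      exists_affineFun_eventuallyEq_extChartAt w (LinearMap.toContinuousLinearMap (b.coord i))
    refine lieDerivBivector_eq_zero_of_coordinates (x := fun i => affineFun (X i) (k i)) b
      (fun y => (isLinearPoissonAt_linearPoissonTensor L y).skew) hXk ?_ ?_ ?_
      f.contMDiff g.contMDiff
    · intro i
      rw [funext (differential_affineFun_verticalLift μ (X i) (k i))]
      exact ((smoothPairing μ (X i)).contMDiff.comp (contMDiff_proj W)).mdifferentiable
        (by simp) w
    · intro i j
      simp only [linearPoissonTensor_affineFun]
      exact (contMDiff_affineFun _ _).mdifferentiable (by simp) w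
    · intro i j
      rw [lieDerivBivector_verticalLift_affineFun, h, neg_zero]

end LinearPoissonTensor

end

theorem theorem11
    {E : Type*} [NormedAddCommGroup E] [NormedSpace ℝ E] [FiniteDimensional ℝ E]
    {M : Type*} [TopologicalSpace M] [ChartedSpace E M] [IsManifold 𝓘(ℝ, E) ∞ M]
    [T2Space M] [SigmaCompactSpace M]
    {F : Type*} [NormedAddCommGroup F] [NormedSpace ℝ F] [FiniteDimensional ℝ F]
    {V : M → Type*} [∀ p, AddCommGroup (V p)] [∀ p, Module ℝ (V p)]
    [∀ p, TopologicalSpace (V p)] [TopologicalSpace (TotalSpace F V)]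
    [FiberBundle F V] [VectorBundle ℝ F V] [ContMDiffVectorBundle ∞ F V 𝓘(ℝ, E)]
    {A : M → Type*} [∀ p, AddTorsor (V p) (A p)]
    [∀ p, TopologicalSpace (A p)] [TopologicalSpace (TotalSpace F A)]
    [FiberBundle F A] [SmoothAffineBundle E F V A]
    (L : LieAlgebroid E (VectorHullModel F) (VectorHull E F V A)) :
    List.TFAE [
      ∃ 𝒜 : LieAffgebroid E F V A, ∀ (X Y : Sec E F A) (p : M),
        hullVector E F A (𝒜.bracket X Y p) = L.bracket (hullSection X) (hullSection Y) p,
      ∀ X Y : Sec E F A, ∃ Z : Sec E F V, ∀ p : M,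
        hullVector E F A (Z p) = L.bracket (hullSection X) (hullSection Y) p,
      ∀ (X Y : Sec E (VectorHullModel F) (VectorHull E F V A)) (p : M),
        extDeriv₁ L (oneSection E F V A) X Y p = 0,
      ∀ (f g : C^∞⟮𝓘(ℝ, E).prod 𝓘(ℝ, AffineDualModel F),
          TotalSpace (AffineDualModel F) (AffineDual E F V A); ℝ⟯)
        (w : TotalSpace (AffineDualModel F) (AffineDual E F V A)),
        lieDerivBivector (𝓘(ℝ, E).prod 𝓘(ℝ, AffineDualModel F))
          (verticalLift (oneSection E F V A)) (linearPoissonTensor L) f g w = 0,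
      ∀ (X : Sec E F A) (a : TotalSpace F A),
        completeLift L (hullSection X) (hullMap E F V A a) ∈
          range (mfderiv (𝓘(ℝ, E).prod 𝓘(ℝ, F)) (𝓘(ℝ, E).prod 𝓘(ℝ, VectorHullModel F))
            (hullMap E F V A) a)] := by
  tfae_have 1 ↔ 2 := exists_lieAffgebroid_iff
  tfae_have 2 ↔ 3 := by
    simp only [exists_hullVector_eq_iff]
    exact extDeriv₁_oneSection_eq_zero_iff.symm
  tfae_have 4 ↔ 3 := lieDerivBivector_verticalLift_eq_zero_iff L (oneSection E F V A)
  tfae_have 5 ↔ 3 := completeLift_tangent_iff L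
  tfae_finish
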